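/- **Setting.** Let $\sigma_+=\begin{pmatrix}0&1\\0&0\end{pmatrix}$, $\sigma_-=\sigma_+^\dagger$, let $\theta_1,\varphi\in\mathbb R$, $T>0$, $\gamma_2>0$, and consider a qubit with signal and noise jump operators $$L_1=\cos\theta_1\,\sigma_++\sin\theta_1e^{i\varphi}\sigma_-,\qquad L_2=\sin\theta_1e^{-i\varphi}\sigma_+-\cos\theta_1\,\sigma_-,$$ evolving under $$\dot\rho=\theta^2\mathcal D_{L_1}(\rho)+\gamma_2\mathcal D_{L_2}(\rho),\qquad \mathcal D_L(\rho)=L\rho L^\dagger-\tfrac12\{L^\dagger L,\rho\},$$ where $\theta=\sqrt{\gamma_1}\ge 0$ is to be estimated. The quantum Fisher information (QFI) about $\theta$ of a family of states $\rho_\theta$ is $\sum_{j,k:\,p_j+p_k\ne0}\frac{2}{p_j+p_k}|\langle\phi_j|\partial_\theta\rho_\theta|\phi_k\rangle|^2$, where $\rho_\theta\phi_j=p_j\phi_j$ is a spectral decomposition. - The *optimal QFI* is the limit as $\theta\to0^+$ of the supremum, over all sequential strategies of total time $T$, of the QFI of the final state. A sequential strategy consists of a noiseless ancilla of any finite dimension,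 a $\theta$-independent initial state of qubit and ancilla, and, for some $M\ge1$, $M$ evolutions of duration $T/M$, each followed by an arbitrary ($\theta$-independent) quantum channel on qubit and ancilla. The *optimal noiseless QFI* is the same quantity without the noise term. - The *measure-and-reset QFI* of a pure state $\psi$ is $\lim_{\theta\to0^+}\lim_{t\to0^+}\frac Tt\,\mathrm{QFI}(\rho_\theta(t))$, where $\rho_\theta(t)$ is the state evolved for a time $t$ from $|\psi\rangle\langle\psi|$. Here $\psi$ is *unextended* if it is a state of the qubit, and *extended* if it is a state of the qubit and a noiseless ancilla (of any finite dimension). If the inner limit is not known to exist, the limit is understood as follows: it equals $F$ if the upper and the lower limits as $t\to0^+$ both tend to $F$ as $\theta\to0^+$. The supremum over states is taken with upper limits. **Statement.** 1. The optimal QFI equals $$\mathcal I=\frac{4T}{\max_\pm(\cos\theta_1\pm\sin\theta_1)^2}.$$ 2. Every normalised eigenvector of $L_2$, as an unextended state, has measure-and-reset QFI $\mathcal I$. So does every extended state $a_1|u_1,e_1\rangle+a_2|u_2,e_2\rangle$ with $u_1,u_2$ normalised eigenvectors of $L_2$, $e_1,e_2$ orthonormal, and $|a_1|^2+|a_2|^2=1$.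 3. There is no extended/unextended gap: the maximal measure-and-reset QFI over extended states and the maximal measure-and-reset QFI over unextended states both equal $\mathcal I$. 4. The optimal noiseless QFI equals $4T\max\{\cos^2\theta_1,\sin^2\theta_1\}$. It is strictly greater than $\mathcal I$ unless $\theta_1=k\pi/4$ for some $k\in\mathbb Z$, in which case the two are equal. -/

import Mathlib

open Filter Topology
open scoped Matrix ENNReal Kronecker ComplexOrder Matrix.Norms.L2Operator

noncomputable section

namespace LindbladEstimation

/-! ### States, channels and the quantum Fisher information -/

section General

variable {d : Type} [Fintype d] [DecidableEq d]

/-- Density matrices: positive semidefinite with unit trace. -/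
def IsDensity (ρ : Matrix d d ℂ) : Prop :=
  ρ.PosSemidef ∧ ρ.trace = 1

/-- Quantum channels (completely positive trace-preserving maps), by a Kraus representation. -/
def IsChannel (Φ : Matrix d d ℂ →ₗ[ℂ] Matrix d d ℂ) : Prop :=
  ∃ (r : ℕ) (K : Fin r → Matrix d d ℂ),
    ∑ j, (K j)ᴴ * K j = 1 ∧ ∀ ρ, Φ ρ = ∑ j, K j * ρ * (K j)ᴴ

/-- `ψ` is a normalised state vector. -/
def IsUnitVec (ψ : d → ℂ) : Prop :=
  star ψ ⬝ᵥ ψ = 1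

/-- The projector `|ψ⟩⟨ψ|`. -/
def pureState (ψ : d → ℂ) : Matrix d d ℂ :=
  Matrix.vecMulVec ψ (star ψ)

open Classical in
/-- The quantum Fisher information of a state `ρ` whose derivative in the parameter is `ρ'`:
`∑ 2 / (p_j + p_k) * |⟨φ_j| ρ' |φ_k⟩|²` over an eigenbasis `ρ φ_j = p_j φ_j`, the sum omitting the
pairs with `p_j + p_k = 0` (for those the summand is `2 / 0 * _ = 0`).
For a non-Hermitian `ρ`, which is not a state, the value is set to `0`. -/
def qfi (ρ ρ' : Matrix d d ℂ) : ℝ :=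
  if h : ρ.IsHermitian then
    ∑ j, ∑ k, 2 / (h.eigenvalues j + h.eigenvalues k) *
      ‖star (⇑(h.eigenvectorBasis j)) ⬝ᵥ (ρ' *ᵥ ⇑(h.eigenvectorBasis k))‖ ^ 2
  else 0

/-- The quantum Fisher information about `θ` of a parametrised family of states. -/
def qfiAt (ρ : ℝ → Matrix d d ℂ) (θ : ℝ) : ℝ :=
  qfi (ρ θ) (Matrix.of fun i j => deriv (fun s => ρ s i j) θ)

/-! ### The Lindblad master equation -/

/-- `ρ ↦ L ρ Lᴴ - (1/2) {Lᴴ L, ρ}`. -/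
def dissipator (L : Matrix d d ℂ) : Matrix d d ℂ →ₗ[ℂ] Matrix d d ℂ :=
  LinearMap.mulLeft ℂ L ∘ₗ LinearMap.mulRight ℂ Lᴴ
    - (1 / 2 : ℂ) • (LinearMap.mulLeft ℂ (Lᴴ * L) + LinearMap.mulRight ℂ (Lᴴ * L))

/-- The generator of the master equation, without Hamiltonian, with one signal jump operator `Ls` of
decay rate `θ ^ 2` (so `θ` is the square root of the signal decay rate) and `N` noise jump
operators `Ln k` of decay rates `γ k`. -/
def generator {N : ℕ} (Ls : Matrix d d ℂ) (γ : Fin N → ℝ) (Ln : Fin N → Matrix d d ℂ) (θ : ℝ) :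
    Matrix d d ℂ →ₗ[ℂ] Matrix d d ℂ :=
  ((θ ^ 2 : ℝ) : ℂ) • dissipator Ls + ∑ k, (γ k : ℂ) • dissipator (Ln k)

/-- The channel `exp (t 𝓛)` given by evolving under the master equation for a time `t`. -/
def evolve {N : ℕ} (Ls : Matrix d d ℂ) (γ : Fin N → ℝ) (Ln : Fin N → Matrix d d ℂ) (θ t : ℝ) :
    Matrix d d ℂ →L[ℂ] Matrix d d ℂ :=
  NormedSpace.exp ((t : ℂ) • LinearMap.toContinuousLinearMap (generator Ls γ Ln θ))

/-! ### Measure-and-reset strategies -/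

/-- The total quantum Fisher information about `θ` of the strategy that `T / t` times prepares `ψ`,
lets it evolve for a time `t` and measures optimally. -/
def resetQFI {N : ℕ} (T : ℝ) (Ls : Matrix d d ℂ) (γ : Fin N → ℝ) (Ln : Fin N → Matrix d d ℂ)
    (ψ : d → ℂ) (θ t : ℝ) : ℝ≥0∞ :=
  ENNReal.ofReal (T / t * qfiAt (fun s => evolve Ls γ Ln s t (pureState ψ)) θ)

/-- The iterated limit of `resetQFI`, first `t → 0` and then the vanishing signal limit `θ → 0`,
taken as a limit superior so that it is defined for every `ψ`. -/
def measureResetQFI {N : ℕ} (T : ℝ) (Ls : Matrix d d ℂ) (γ : Fin N → ℝ)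
    (Ln : Fin N → Matrix d d ℂ) (ψ : d → ℂ) : ℝ≥0∞ :=
  limsup (fun θ : ℝ => limsup (fun t : ℝ => resetQFI T Ls γ Ln ψ θ t) (𝓝[>] 0)) (𝓝[>] 0)

/-- The iterated limit of `resetQFI`, first `t → 0` and then `θ → 0`, exists and equals `F`: the
upper and the lower limits as `t → 0` both converge to `F` as `θ → 0`. -/
def HasMeasureResetQFI {N : ℕ} (T : ℝ) (Ls : Matrix d d ℂ) (γ : Fin N → ℝ)
    (Ln : Fin N → Matrix d d ℂ) (ψ : d → ℂ) (F : ℝ≥0∞) : Prop :=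
  Tendsto (fun θ : ℝ => limsup (fun t : ℝ => resetQFI T Ls γ Ln ψ θ t) (𝓝[>] 0)) (𝓝[>] 0) (𝓝 F) ∧
  Tendsto (fun θ : ℝ => liminf (fun t : ℝ => resetQFI T Ls γ Ln ψ θ t) (𝓝[>] 0)) (𝓝[>] 0) (𝓝 F)

/-! ### Sequential strategies with control -/

/-- The state after `m` rounds, each an evolution for a time `τ` followed by a control `C m`. -/
def controlledState {N : ℕ} (Ls : Matrix d d ℂ) (γ : Fin N → ℝ) (Ln : Fin N → Matrix d d ℂ)
    (C : ℕ → Matrix d d ℂ →ₗ[ℂ] Matrix d d ℂ) (ρ : Matrix d d ℂ) (τ θ : ℝ) : ℕ → Matrix d d ℂ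
  | 0 => ρ
  | m + 1 => C m (evolve Ls γ Ln θ τ (controlledState Ls γ Ln C ρ τ θ m))

end General

/-- `L ⊗ I`, with a noiseless ancilla of dimension `n`. -/
def extend (n : ℕ) (L : Matrix (Fin 2) (Fin 2) ℂ) : Matrix (Fin 2 × Fin n) (Fin 2 × Fin n) ℂ :=
  L ⊗ₖ (1 : Matrix (Fin n) (Fin n) ℂ)

/-- The supremum, over all sequential strategies for a qubit with total time `T`, of the quantum
Fisher information about `θ` of the final state. A strategy consists of a number `M ≥ 1` of
evolutions of duration `T / M` (arbitrarily fast control means arbitrarily large `M`), a noiseless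
ancilla of any dimension `n`, an initial state of system and ancilla, and arbitrary channels on
system and ancilla applied after each evolution. -/
def sequentialQFI {N : ℕ} (T : ℝ) (Ls : Matrix (Fin 2) (Fin 2) ℂ) (γ : Fin N → ℝ)
    (Ln : Fin N → Matrix (Fin 2) (Fin 2) ℂ) (θ : ℝ) : ℝ≥0∞ :=
  sSup {F | ∃ (M n : ℕ) (ρ : Matrix (Fin 2 × Fin n) (Fin 2 × Fin n) ℂ)
    (C : ℕ → Matrix (Fin 2 × Fin n) (Fin 2 × Fin n) ℂ →ₗ[ℂ]
      Matrix (Fin 2 × Fin n) (Fin 2 × Fin n) ℂ),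
    0 < M ∧ IsDensity ρ ∧ (∀ m, IsChannel (C m)) ∧
    F = ENNReal.ofReal (qfiAt (fun s =>
      controlledState (extend n Ls) γ (fun k => extend n (Ln k)) C ρ (T / M) s M) θ)}

/-- `F` is the optimal quantum Fisher information, in the vanishing signal limit, of sequential
strategies with fast and precise control and noiseless ancillae. -/
def IsOptimalQFI {N : ℕ} (T : ℝ) (Ls : Matrix (Fin 2) (Fin 2) ℂ) (γ : Fin N → ℝ)
    (Ln : Fin N → Matrix (Fin 2) (Fin 2) ℂ) (F : ℝ≥0∞) : Prop :=
  Tendsto (sequentialQFI T Ls γ Ln) (𝓝[>] 0) (𝓝 F)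

/-- `F` is the optimal quantum Fisher information of unextended measure-and-reset strategies. -/
def IsOptimalUnextendedQFI {N : ℕ} (T : ℝ) (Ls : Matrix (Fin 2) (Fin 2) ℂ) (γ : Fin N → ℝ)
    (Ln : Fin N → Matrix (Fin 2) (Fin 2) ℂ) (F : ℝ≥0∞) : Prop :=
  IsGreatest {G | ∃ ψ : Fin 2 → ℂ, IsUnitVec ψ ∧ G = measureResetQFI T Ls γ Ln ψ} F

/-- `F` is the optimal quantum Fisher information of extended measure-and-reset strategies. -/
def IsOptimalExtendedQFI {N : ℕ} (T : ℝ) (Ls : Matrix (Fin 2) (Fin 2) ℂ) (γ : Fin N → ℝ)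
    (Ln : Fin N → Matrix (Fin 2) (Fin 2) ℂ) (F : ℝ≥0∞) : Prop :=
  IsGreatest {G | ∃ (n : ℕ) (ψ : Fin 2 × Fin n → ℂ), IsUnitVec ψ ∧
    G = measureResetQFI T (extend n Ls) γ (fun k => extend n (Ln k)) ψ} F

/-! ### The in-plane qubit operators -/

/-- `σ₊ = (σ_x + i σ_y) / 2`. -/
def sigmaPlus : Matrix (Fin 2) (Fin 2) ℂ := !![0, 1; 0, 0]

/-- `σ₋ = (σ_x - i σ_y) / 2`. -/
def sigmaMinus : Matrix (Fin 2) (Fin 2) ℂ := !![0, 0; 1, 0]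

/-- The signal operator `cos θ₁ σ₊ + sin θ₁ e^{iφ} σ₋`. -/
def signalOp (θ₁ φ : ℝ) : Matrix (Fin 2) (Fin 2) ℂ :=
  (Real.cos θ₁ : ℂ) • sigmaPlus + ((Real.sin θ₁ : ℂ) * Complex.exp (Complex.I * φ)) • sigmaMinus

/-- The noise operator `sin θ₁ e^{-iφ} σ₊ - cos θ₁ σ₋`. -/
def noiseOp (θ₁ φ : ℝ) : Matrix (Fin 2) (Fin 2) ℂ :=
  ((Real.sin θ₁ : ℂ) * Complex.exp (-(Complex.I * φ))) • sigmaPlus - (Real.cos θ₁ : ℂ) • sigmaMinus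

/-- `ψ` is a normalised eigenvector of `L`. -/
def IsEigenstate (L : Matrix (Fin 2) (Fin 2) ℂ) (ψ : Fin 2 → ℂ) : Prop :=
  IsUnitVec ψ ∧ ∃ μ : ℂ, L *ᵥ ψ = μ • ψ

/-- `4T / max_± (cos θ₁ ± sin θ₁)²`. -/
def noisyValue (T θ₁ : ℝ) : ℝ :=
  4 * T / max ((Real.cos θ₁ + Real.sin θ₁) ^ 2) ((Real.cos θ₁ - Real.sin θ₁) ^ 2)

/-- `4T max {cos² θ₁, sin² θ₁}`. -/
def noiselessValue (T θ₁ : ℝ) : ℝ :=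
  4 * T * max (Real.cos θ₁ ^ 2) (Real.sin θ₁ ^ 2)

end LindbladEstimation

end

/-! The upper bound rests on a certificate. If the positive semidefinite block matrix `W = [[ρ, B],
[C, D]]` has `B + C = ρ'`, then the quantum Fisher information (QFI) of `(ρ, ρ')` is at most `4 tr
D`: it is the supremum over Hermitian `X` of `2 tr (ρ' X) - tr (ρ X²)`, and testing `W` against the
column `(X, -2)` bounds that functional. Here `W` plays the role of a purification together with its
derivative, and `tr D` that of the squared norm of the derivative. A `θ`-independent initial state
has the certificate `ρ ⊕ 0`; a channel acts on all blocks alike and preserves `tr D`; the evolution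
lifts to a completely positive semigroup on block matrices with jump operators `[[L, 0], [Lt, L]]`,
under which `tr D` grows at the rate `tr (∑ Ltᴴ Lt ρ)`. So if `∑ Ltᴴ Lt ≤ κ`, every sequential
strategy of total time `T` has QFI at most `4 T κ`.

The derivatives `Lt` of the jump operators `(θ L₁, √γ L₂)` are free up to mixing by an
anti-Hermitian matrix. This allows `Lt = (L₁ + x L₂, O(θ))` for any `x` with `x L₁ᴴ L₂` Hermitian,
so that `κ` tends to a bound on `(L₁ + x L₂)ᴴ (L₁ + x L₂)` as `θ → 0`. For the operators at hand, `x
= ξ e^{iφ}` with a suitable real `ξ` makes that product the scalar `g = 1 / (|cos θ₁| + |sin θ₁|)²`,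
and `4 T g` is the claimed value.

For the lower bound, prepare an eigenvector `u` of `L₂` and measure the projector `Q` onto its
complement. The noise causes no transition to first order, so in a short time `τ` the click
probability is about `θ² g' τ`, with `g' = |⟨u⊥| L₁ |u⟩|²`. Its derivative is about `2 θ g' τ`, and
`X = (2/θ) Q` gives QFI about `4 g' τ`. The eigenvalue equation forces `g' = g` for every
eigenvector. A flag that records clicks turns this measure-and-reset scheme into a sequential
strategy.

The main steps are `IsGauge.certificate_evolve`, `IsCertificate.qfi_le`, `IsCertificate.le_qfi`,
`isGauge_noisy`, `exists_optimal_admixture`, `IsEigenstate.rate` and `isOptimalQFI_of_detects`. -/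

noncomputable section

namespace LindbladEstimation

/-! ### One-parameter semigroups on finite-dimensional spaces -/

section Flow

variable {V V' : Type*} [NormedAddCommGroup V] [NormedSpace ℂ V] [FiniteDimensional ℂ V]
  [NormedAddCommGroup V'] [NormedSpace ℂ V'] [FiniteDimensional ℂ V']

/-- The semigroup `exp (t A)` generated by a linear endomorphism. -/
def flow (A : V →ₗ[ℂ] V) (t : ℝ) : V →L[ℂ] V :=
  NormedSpace.exp ((t : ℂ) • LinearMap.toContinuousLinearMap A)

theorem hasSum_exp_apply (A : V →L[ℂ] V) (v : V) :
    HasSum (fun n : ℕ => ((n.factorial : ℂ)⁻¹) • (A ^ n) v) (NormedSpace.exp A v) := by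
  have : CompleteSpace V := FiniteDimensional.complete ℂ V
  have h := NormedSpace.exp_series_hasSum_exp' (𝕂 := ℂ) A
  simpa using (ContinuousLinearMap.apply ℂ V v).hasSum h

/-- Compare the exponential series term by term. This transfers identities between generators to
their semigroups: block components, traces, ancillae and difference quotients are all handled by a
suitable `S`. -/
theorem flow_intertwine {A : V →ₗ[ℂ] V} {B : V' →ₗ[ℂ] V'} (S : V →ₗ[ℂ] V')
    (h : ∀ v, S (A v) = B (S v)) (t : ℝ) (v : V) : S (flow A t v) = flow B t (S v) := by
  have h1 := (LinearMap.toContinuousLinearMap S).hasSum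
    (hasSum_exp_apply ((t : ℂ) • LinearMap.toContinuousLinearMap A) v)
  have h2 := hasSum_exp_apply ((t : ℂ) • LinearMap.toContinuousLinearMap B) (S v)
  refine h1.unique (h2.congr_fun ?_)
  intro n
  have key : ∀ n : ℕ, S (((((t : ℂ) • LinearMap.toContinuousLinearMap A)) ^ n) v)
      = ((((t : ℂ) • LinearMap.toContinuousLinearMap B)) ^ n) (S v) := by
    intro n
    induction n with
    | zero => simp
    | succ n ih =>
      rw [pow_succ', pow_succ', mul_apply_eq_comp, mul_apply_eq_comp, ← ih]
      simp [h]
  rw [← key n]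
  simp only [map_smul, LinearMap.coe_toContinuousLinearMap']

@[simp] theorem flow_zero_left (t : ℝ) : flow (0 : V →ₗ[ℂ] V) t = 1 := by
  simp [flow, NormedSpace.exp_zero]

@[simp] theorem flow_zero_right (A : V →ₗ[ℂ] V) : flow A 0 = 1 := by
  simp [flow, NormedSpace.exp_zero]

theorem hasDerivAt_flow (A : V →ₗ[ℂ] V) (f : V →ₗ[ℂ] ℂ) (v : V) (t : ℝ) :
    HasDerivAt (fun s : ℝ => f (flow A s v)) (f (A (flow A t v))) t := by
  have : CompleteSpace V := FiniteDimensional.complete ℂ V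
  have h := hasDerivAt_exp_smul_const' (𝕂 := ℂ) (LinearMap.toContinuousLinearMap A) (t : ℂ)
  have h2 := ((LinearMap.toContinuousLinearMap f).comp
    (ContinuousLinearMap.apply ℂ V v)).hasFDerivAt.comp_hasDerivAt (t : ℂ) h
  simpa [flow, Function.comp_def] using h2.comp_ofReal

theorem continuous_exp_clm : Continuous (NormedSpace.exp : (V →L[ℂ] V) → (V →L[ℂ] V)) := by
  have : CompleteSpace V := FiniteDimensional.complete ℂ V
  let : NormedAlgebra ℚ (V →L[ℂ] V) := NormedAlgebra.restrictScalars ℚ ℂ _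
  exact NormedSpace.exp_continuous

-- Telescoping over the position where `P` is replaced by `E`. The assumption `1 ≤ M` allows the
-- exponent `n` in place of `n - 1`.
omit [FiniteDimensional ℂ V] in
theorem norm_pow_sub_pow_le (P E : V →L[ℂ] V) {M : ℝ} (hP : ‖P‖ ≤ M) (hE : ‖E‖ ≤ M) (hM : 1 ≤ M)
    (n : ℕ) : ‖P ^ n - E ^ n‖ ≤ n * ‖P - E‖ * M ^ n := by
  have hM0 : 0 ≤ M := zero_le_one.trans hM
  have hpow : ∀ n : ℕ, ‖P ^ n‖ ≤ M ^ n := fun n => by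
    induction n with
    | zero => rw [pow_zero, pow_zero]; exact ContinuousLinearMap.norm_id_le
    | succ n ih =>
      rw [pow_succ, pow_succ]
      exact (norm_mul_le _ _).trans (mul_le_mul ih hP (norm_nonneg _) (by positivity))
  induction n with
  | zero => simp
  | succ n ih =>
    have e : P ^ (n + 1) - E ^ (n + 1) = P ^ n * (P - E) + (P ^ n - E ^ n) * E := by
      rw [pow_succ, pow_succ, mul_sub, sub_mul]; abel
    rw [e]
    have h1 : ‖P ^ n * (P - E)‖ ≤ M ^ (n + 1) * ‖P - E‖ :=
      (norm_mul_le _ _).trans (mul_le_mul_of_nonneg_right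
        ((hpow n).trans (pow_le_pow_right₀ hM n.le_succ)) (norm_nonneg _))
    have h2 : ‖(P ^ n - E ^ n) * E‖ ≤ n * ‖P - E‖ * M ^ n * M :=
      (norm_mul_le _ _).trans (mul_le_mul ih hE (norm_nonneg _) (by positivity))
    calc _ ≤ _ := norm_add_le _ _
      _ ≤ M ^ (n + 1) * ‖P - E‖ + n * ‖P - E‖ * M ^ n * M := add_le_add h1 h2
      _ = _ := by push_cast; ring

/-- The steps `1 + h A + h² R` and `exp (h A)` agree to first order, so `n` of them with `h = t / n`
differ by `n · o(1/n)`. The second-order term `R` is arbitrary; it is chosen later to make each step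
manifestly positive. -/
theorem tendsto_euler (A R : V →L[ℂ] V) {t : ℝ} (ht : 0 < t) :
    Tendsto (fun n : ℕ => (1 + ((t / n : ℝ) : ℂ) • A + ((t / n : ℝ) : ℂ) ^ 2 • R) ^ n) atTop
      (𝓝 (NormedSpace.exp ((t : ℂ) • A))) := by
  have : CompleteSpace V := FiniteDimensional.complete ℂ V
  let P : ℝ → V →L[ℂ] V := fun h => 1 + (h : ℂ) • A + (h : ℂ) ^ 2 • R
  let E : ℝ → V →L[ℂ] V := fun h => NormedSpace.exp ((h : ℂ) • A)
  have hP : HasDerivAt P A 0 := by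
    have h1 : HasDerivAt (fun z : ℂ => 1 + z • A + z ^ 2 • R) A 0 := by
      have := (((hasDerivAt_id (0 : ℂ)).smul_const A).const_add 1).add
        (((hasDerivAt_id (0 : ℂ)).pow 2).smul_const R)
      simpa [Pi.add_def] using this
    have h2 : HasDerivAt P (Complex.ofRealCLM 1 • A) 0 :=
      HasDerivAt.scomp (0 : ℝ) (by simpa using h1) Complex.ofRealCLM.hasDerivAt
    rwa [Complex.ofRealCLM_apply, Complex.ofReal_one, one_smul] at h2
  have hE : HasDerivAt E A 0 := by
    have h1 := (hasDerivAt_exp_smul_const (𝕂 := ℂ) A (0 : ℂ))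
    simp only [zero_smul, NormedSpace.exp_zero, one_mul] at h1
    have h2 : HasDerivAt E (Complex.ofRealCLM 1 • A) 0 :=
      HasDerivAt.scomp (g₁ := fun u : ℂ => NormedSpace.exp (u • A)) (0 : ℝ) (by simpa using h1) Complex.ofRealCLM.hasDerivAt
    rwa [Complex.ofRealCLM_apply, Complex.ofReal_one, one_smul] at h2
  have hP0 : P 0 = 1 := by simp [P]
  have hE0 : E 0 = 1 := by simp [E, NormedSpace.exp_zero]
  have hseq : Tendsto (fun n : ℕ => t / (n : ℝ)) atTop (𝓝[>] 0) := by
    refine tendsto_nhdsWithin_iff.mpr ⟨tendsto_const_div_atTop_nhds_zero_nat t, ?_⟩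
    filter_upwards [eventually_gt_atTop 0] with n hn
    exact div_pos ht (by exact_mod_cast hn)
  -- With `h = t / n`, the `n`-th power of this bound is `exp (t (‖A‖ + 1))`, independent of `n`.
  have hbound : ∀ Q : ℝ → V →L[ℂ] V, HasDerivAt Q A 0 → Q 0 = 1 →
      ∀ᶠ h in 𝓝[>] (0 : ℝ), ‖Q h‖ ≤ Real.exp (h * (‖A‖ + 1)) := by
    intro Q hQ hQ0
    have h1 := hQ.tendsto_slope_zero_right.norm
    have h2 := h1.eventually (gt_mem_nhds (lt_add_one ‖A‖))
    filter_upwards [h2, self_mem_nhdsWithin] with h hh hpos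
    have hpos' : (0 : ℝ) < h := hpos
    rw [zero_add, hQ0, norm_smul, norm_inv, Real.norm_of_nonneg hpos'.le,
      inv_mul_lt_iff₀ hpos'] at hh
    calc ‖Q h‖ = ‖1 + (Q h - 1)‖ := by rw [add_sub_cancel]
      _ ≤ ‖(1 : V →L[ℂ] V)‖ + ‖Q h - 1‖ := norm_add_le _ _
      _ ≤ 1 + h * (‖A‖ + 1) := add_le_add ContinuousLinearMap.norm_id_le hh.le
      _ ≤ _ := by rw [add_comm]; exact Real.add_one_le_exp _
  have hdiff : Tendsto (fun n : ℕ => (n : ℝ) * ‖P (t / n) - E (t / n)‖) atTop (𝓝 0) := by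
    have h1 := (hP.sub hE).tendsto_slope_zero_right.norm
    have h2 := (h1.comp hseq).const_mul t
    simp only [sub_self, norm_zero, mul_zero] at h2
    refine h2.congr' ?_
    filter_upwards [eventually_gt_atTop 0] with n hn
    have hn' : (0 : ℝ) < n := by exact_mod_cast hn
    simp only [Function.comp_apply, zero_add, Pi.sub_apply, hP0, hE0, sub_self, sub_zero, norm_smul,
      norm_inv, norm_div, Real.norm_of_nonneg ht.le, Real.norm_of_nonneg hn'.le]
    field_simp
  have hfin : Tendsto (fun n : ℕ => P (t / n) ^ n - E (t / n) ^ n) atTop (𝓝 0) := by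
    have h0 : Tendsto (fun n : ℕ => (n : ℝ) * ‖P (t / n) - E (t / n)‖
        * Real.exp (t * (‖A‖ + 1))) atTop (𝓝 0) := by
      simpa using hdiff.mul_const (Real.exp (t * (‖A‖ + 1)))
    refine squeeze_zero_norm' ?_ h0
    filter_upwards [hseq.eventually (hbound P hP hP0), hseq.eventually (hbound E hE hE0),
      eventually_gt_atTop 0] with n h1 h2 hn
    have hn' : (0 : ℝ) < n := by exact_mod_cast hn
    refine (norm_pow_sub_pow_le _ _ h1 h2 (Real.one_le_exp (by positivity)) n).trans_eq ?_
    rw [← Real.exp_nat_mul]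
    congr 2
    field_simp
  have hEn : ∀ᶠ n : ℕ in atTop, E (t / n) ^ n = NormedSpace.exp ((t : ℂ) • A) := by
    filter_upwards [eventually_gt_atTop 0] with n hn
    have hn' : (n : ℂ) ≠ 0 := by exact_mod_cast hn.ne'
    let : NormedAlgebra ℚ (V →L[ℂ] V) := NormedAlgebra.restrictScalars ℚ ℂ _
    simp only [E]
    rw [← NormedSpace.exp_nsmul, ← Nat.cast_smul_eq_nsmul ℂ, smul_smul]
    congr 2
    push_cast
    field_simp
  have h3 := hfin.add_const (NormedSpace.exp ((t : ℂ) • A))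
  rw [zero_add] at h3
  refine h3.congr' ?_
  filter_upwards [hEn] with n hn
  rw [hn, sub_add_cancel]

/-- If the Euler steps `v + h A v + h² R v` keep a closed set, so does the semigroup. -/
theorem flow_mem_of_euler {A R : V →ₗ[ℂ] V} {K : Set V} (hK : IsClosed K)
    (hstep : ∀ h : ℝ, 0 ≤ h → ∀ v ∈ K, v + (h : ℂ) • A v + ((h : ℂ) ^ 2) • R v ∈ K)
    {t : ℝ} (ht : 0 ≤ t) {v : V} (hv : v ∈ K) : flow A t v ∈ K := by
  rcases ht.eq_or_lt with rfl | ht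
  · simpa using hv
  have h1 := (ContinuousLinearMap.apply ℂ V v).continuous.tendsto _ |>.comp
    (tendsto_euler (LinearMap.toContinuousLinearMap A) (LinearMap.toContinuousLinearMap R) ht)
  refine hK.mem_of_tendsto h1 (Eventually.of_forall fun n => ?_)
  have key : ∀ m : ℕ, ((1 + ((t / n : ℝ) : ℂ) • LinearMap.toContinuousLinearMap A
      + ((t / n : ℝ) : ℂ) ^ 2 • LinearMap.toContinuousLinearMap R) ^ m) v ∈ K := by
    intro m
    induction m with
    | zero => simpa using hv
    | succ m ih =>
      rw [pow_succ', mul_apply_eq_comp]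
      exact hstep (t / n) (by positivity) _ ih
  exact key n

end Flow

/-! ### Dependence of the semigroup on a parameter -/

section Param

variable {V : Type*} [NormedAddCommGroup V] [NormedSpace ℂ V] [FiniteDimensional ℂ V]

/-- The generator `s² D + B`. -/
def quadGen (D B : V →ₗ[ℂ] V) (s : ℝ) : V →ₗ[ℂ] V := ((s ^ 2 : ℝ) : ℂ) • D + B

/-- The joint generator of a state and of its difference quotient between parameters `θ`, `s`;
for `s = θ` the second component is the derivative in the parameter. -/
def tangentGen (D B : V →ₗ[ℂ] V) (θ s : ℝ) : V × V →ₗ[ℂ] V × V :=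
  (quadGen D B θ ∘ₗ LinearMap.fst ℂ V V).prod
    (((s + θ : ℝ) : ℂ) • D ∘ₗ LinearMap.fst ℂ V V + quadGen D B s ∘ₗ LinearMap.snd ℂ V V)

/-- Since `(s² - θ²) / (s - θ) = s + θ`, the generator of the pair (state, difference quotient) has
no singularity at `s = θ`. The pair evolves linearly even before the limit is taken. -/
theorem flow_tangentGen (D B : V →ₗ[ℂ] V) {θ s : ℝ} (hs : s ≠ θ) (t : ℝ) (u v : V) :
    flow (tangentGen D B θ s) t (u, ((s - θ : ℝ) : ℂ)⁻¹ • (v - u)) =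
      (flow (quadGen D B θ) t u,
        ((s - θ : ℝ) : ℂ)⁻¹ • (flow (quadGen D B s) t v - flow (quadGen D B θ) t u)) := by
  have hne : ((s - θ : ℝ) : ℂ) ≠ 0 := by exact_mod_cast sub_ne_zero.mpr hs
  let P : V × V →ₗ[ℂ] V × V := (quadGen D B θ).prodMap (quadGen D B s)
  let S : V × V →ₗ[ℂ] V × V := (LinearMap.fst ℂ V V).prod
    (((s - θ : ℝ) : ℂ)⁻¹ • (LinearMap.snd ℂ V V - LinearMap.fst ℂ V V))
  have h1 := flow_intertwine (A := P) (B := tangentGen D B θ s) S (by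
    rintro ⟨a, b⟩
    simp only [P, S, tangentGen, quadGen, LinearMap.prod_apply, Function.prod, LinearMap.prodMap_apply,
      LinearMap.fst_apply, LinearMap.snd_apply, LinearMap.smul_apply, LinearMap.sub_apply,
      LinearMap.add_apply, LinearMap.comp_apply, map_smul, map_sub]
    congr 1
    have hne' : (s : ℂ) - θ ≠ 0 := by simpa using hne
    push_cast
    match_scalars <;> field_simp
    ring) t (u, v)
  have h2 := flow_intertwine (A := P) (B := quadGen D B θ) (LinearMap.fst ℂ V V) (by simp [P]) t (u, v)
  have h3 := flow_intertwine (A := P) (B := quadGen D B s) (LinearMap.snd ℂ V V) (by simp [P]) t (u, v)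
  simp only [LinearMap.fst_apply, LinearMap.snd_apply] at h2 h3
  simp only [S, LinearMap.prod_apply, Function.prod, LinearMap.fst_apply, LinearMap.snd_apply,
    LinearMap.smul_apply, LinearMap.sub_apply, h2, h3] at h1
  exact h1.symm

/-- Letting `s → θ` in `flow_tangentGen` only needs continuity of the exponential in its generator,
which replaces Duhamel's formula. -/
theorem HasDerivAt.flow_quadGen (D B : V →ₗ[ℂ] V) {θ : ℝ} (t : ℝ) {ρ : ℝ → V} {ρ' : V}
    (h : HasDerivAt ρ ρ' θ) :
    HasDerivAt (fun s => flow (quadGen D B s) t (ρ s))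
      (flow (tangentGen D B θ θ) t (ρ θ, ρ')).2 θ := by
  rw [hasDerivAt_iff_tendsto_slope] at h ⊢
  let X : ℝ → (V × V →L[ℂ] V × V) := fun s => LinearMap.toContinuousLinearMap (tangentGen D B θ s)
  have hX : Continuous X := by
    let P : V × V →L[ℂ] V × V := LinearMap.toContinuousLinearMap
      ((quadGen D B θ ∘ₗ LinearMap.fst ℂ V V).prod
        (((θ : ℝ) : ℂ) • D ∘ₗ LinearMap.fst ℂ V V + B ∘ₗ LinearMap.snd ℂ V V))
    let Q : V × V →L[ℂ] V × V := LinearMap.toContinuousLinearMap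
      ((0 : V × V →ₗ[ℂ] V).prod (D ∘ₗ LinearMap.fst ℂ V V))
    let R : V × V →L[ℂ] V × V := LinearMap.toContinuousLinearMap
      ((0 : V × V →ₗ[ℂ] V).prod (D ∘ₗ LinearMap.snd ℂ V V))
    have e : X = fun s : ℝ => P + (s : ℂ) • Q + ((s : ℂ) ^ 2) • R := by
      funext s
      ext v <;> simp [X, P, Q, R, tangentGen, quadGen, add_smul]
      all_goals module
    rw [e]
    fun_prop
  have hflow : Tendsto (fun s => flow (tangentGen D B θ s) t) (𝓝[≠] θ)
      (𝓝 (flow (tangentGen D B θ θ) t)) := by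
    have : Continuous fun s => NormedSpace.exp ((t : ℂ) • X s) :=
      continuous_exp_clm.comp (hX.const_smul (t : ℂ))
    exact (this.tendsto θ).mono_left nhdsWithin_le_nhds
  have hpair : Tendsto (fun s => (ρ θ, slope ρ θ s)) (𝓝[≠] θ) (𝓝 (ρ θ, ρ')) :=
    tendsto_const_nhds.prodMk_nhds h
  have := (continuous_snd.tendsto _).comp ((isBoundedBilinearMap_apply.continuous.tendsto (_, _)).comp
    (hflow.prodMk_nhds hpair))
  refine this.congr' ?_
  filter_upwards [self_mem_nhdsWithin] with s hs
  have e : ∀ w : V, (s - θ)⁻¹ • w = ((s - θ : ℝ) : ℂ)⁻¹ • w := by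
    intro w
    rw [← Complex.ofReal_inv, Complex.coe_smul]
  simp only [Function.comp_apply, slope_def_module, e]
  rw [flow_tangentGen D B hs]

end Param

/-! ### Completely positive semigroups -/

section CP

variable {m : Type*} [Fintype m] [DecidableEq m]

omit [DecidableEq m] in
theorem isClosed_posSemidef : IsClosed {W : Matrix m m ℂ | W.PosSemidef} := by
  have h : {W : Matrix m m ℂ | W.PosSemidef} =
      {W | Wᴴ = W} ∩ ⋂ x : m → ℂ, {W | 0 ≤ star x ⬝ᵥ (W *ᵥ x)} := by
    ext W
    simp [Matrix.posSemidef_iff_dotProduct_mulVec, Matrix.IsHermitian]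
  rw [h]
  refine (isClosed_eq (Continuous.matrix_conjTranspose continuous_id) continuous_id).inter
    (isClosed_iInter fun x => ?_)
  have hc : Continuous fun W : Matrix m m ℂ => star x ⬝ᵥ (W *ᵥ x) := by fun_prop
  exact isClosed_le continuous_const hc

/-- The map `W ↦ ∑ J W Jᴴ + G W + W Gᴴ`. -/
def cpGen {ι : Type*} [Fintype ι] (J : ι → Matrix m m ℂ) (G : Matrix m m ℂ) :
    Matrix m m ℂ →ₗ[ℂ] Matrix m m ℂ :=
  ∑ k, LinearMap.mulLeft ℂ (J k) ∘ₗ LinearMap.mulRight ℂ (J k)ᴴ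
    + (LinearMap.mulLeft ℂ G + LinearMap.mulRight ℂ Gᴴ)

theorem cpGen_apply {ι : Type*} [Fintype ι] (J : ι → Matrix m m ℂ) (G W : Matrix m m ℂ) :
    cpGen J G W = ∑ k, J k * W * (J k)ᴴ + (G * W + W * Gᴴ) := by
  simp [cpGen, LinearMap.sum_apply, mul_assoc]

/-- With the second-order term `G W Gᴴ`, an Euler step is `(1 + h G) W (1 + h G)ᴴ + h ∑ J W Jᴴ`, a
sum of positive semidefinite matrices. -/
theorem posSemidef_flow_cpGen {ι : Type*} [Fintype ι] (J : ι → Matrix m m ℂ) (G : Matrix m m ℂ)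
    {t : ℝ} (ht : 0 ≤ t) {W : Matrix m m ℂ} (hW : W.PosSemidef) :
    (flow (cpGen J G) t W).PosSemidef := by
  refine flow_mem_of_euler (R := LinearMap.mulLeft ℂ G ∘ₗ LinearMap.mulRight ℂ Gᴴ)
    isClosed_posSemidef (fun h hh v hv => ?_) ht hW
  have hh' : (0 : ℂ) ≤ h := by exact_mod_cast hh
  have h1 : ((1 + (h : ℂ) • G) * v * (1 + (h : ℂ) • G)ᴴ).PosSemidef :=
    Matrix.PosSemidef.mul_mul_conjTranspose_same hv _
  have h2 : ((h : ℂ) • ∑ k, J k * v * (J k)ᴴ).PosSemidef :=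
    (Matrix.posSemidef_sum _ fun k _ => Matrix.PosSemidef.mul_mul_conjTranspose_same hv _).smul hh'
  have h3 := h1.add h2
  have e : v + (h : ℂ) • cpGen J G v + ((h : ℂ) ^ 2) •
      (LinearMap.mulLeft ℂ G ∘ₗ LinearMap.mulRight ℂ Gᴴ) v
      = (1 + (h : ℂ) • G) * v * (1 + (h : ℂ) • G)ᴴ + (h : ℂ) • ∑ k, J k * v * (J k)ᴴ := by
    rw [cpGen_apply]
    simp only [Matrix.conjTranspose_add, Matrix.conjTranspose_one, Matrix.conjTranspose_smul,
      RCLike.star_def, Complex.conj_ofReal, add_mul, mul_add, one_mul, mul_one, smul_mul_assoc,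
      mul_smul_comm, LinearMap.comp_apply, LinearMap.mulLeft_apply, LinearMap.mulRight_apply,
      smul_add, mul_assoc]
    module
  rw [Set.mem_ofPred_eq, e]
  exact h3

end CP

/-! ### Joint evolution of a state and its derivative -/

section Block

variable {d : Type} [Fintype d] [DecidableEq d]

/-- Jump operators `L k` of the master equation at signal strength `θ`, with derivatives `Lt k` in
`θ` in a gauge that makes the bound `κ` on the growth rate of the quantum Fisher information
manifest. -/
structure IsGauge {N : ℕ} (Ls : Matrix d d ℂ) (γ : Fin N → ℝ) (Ln : Fin N → Matrix d d ℂ) (θ κ : ℝ)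
    {r : ℕ} (L Lt : Fin r → Matrix d d ℂ) : Prop where
  gen : ∀ ρ, generator Ls γ Ln θ ρ =
    ∑ k, (L k * ρ * (L k)ᴴ - (1 / 2 : ℂ) • ((L k)ᴴ * L k * ρ + ρ * ((L k)ᴴ * L k)))
  tangent : ∀ ρ, ((θ + θ : ℝ) : ℂ) • dissipator Ls ρ =
    ∑ k, (L k * ρ * (Lt k)ᴴ + Lt k * ρ * (L k)ᴴ - ρ * ((Lt k)ᴴ * L k) - (L k)ᴴ * Lt k * ρ)
  bound : ((κ : ℂ) • (1 : Matrix d d ℂ) - ∑ k, (Lt k)ᴴ * Lt k).PosSemidef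

/-- The generator of the joint evolution of a state and its derivative. -/
def blockGen {r : ℕ} (L Lt : Fin r → Matrix d d ℂ) :
    Matrix (d ⊕ d) (d ⊕ d) ℂ →ₗ[ℂ] Matrix (d ⊕ d) (d ⊕ d) ℂ :=
  cpGen (fun k => Matrix.fromBlocks (L k) 0 (Lt k) (L k))
    (∑ k, Matrix.fromBlocks (-(1 / 2 : ℂ) • ((L k)ᴴ * L k)) 0 (-((L k)ᴴ * Lt k))
      (-(1 / 2 : ℂ) • ((L k)ᴴ * L k)))

/-- The state carried by a block matrix. -/
def blockState : Matrix (d ⊕ d) (d ⊕ d) ℂ →ₗ[ℂ] Matrix d d ℂ where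
  toFun W := W.toBlocks₁₁
  map_add' _ _ := rfl
  map_smul' _ _ := rfl

/-- The derivative carried by a block matrix. -/
def blockTangent : Matrix (d ⊕ d) (d ⊕ d) ℂ →ₗ[ℂ] Matrix d d ℂ where
  toFun W := W.toBlocks₁₂ + W.toBlocks₂₁
  map_add' _ _ := by ext; simp [Matrix.toBlocks₁₂, Matrix.toBlocks₂₁]; ring
  map_smul' _ _ := by ext; simp [Matrix.toBlocks₁₂, Matrix.toBlocks₂₁]; ring

/-- The trace of the lower right block. -/
def blockWeight : Matrix (d ⊕ d) (d ⊕ d) ℂ →ₗ[ℂ] ℂ where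
  toFun W := W.toBlocks₂₂.trace
  map_add' _ _ := Matrix.trace_add _ _
  map_smul' c W := Matrix.trace_smul c W.toBlocks₂₂

omit [Fintype d] [DecidableEq d] in
@[simp] theorem blockState_fromBlocks (A B C D : Matrix d d ℂ) :
    blockState (Matrix.fromBlocks A B C D) = A := rfl

omit [Fintype d] [DecidableEq d] in
@[simp] theorem blockTangent_fromBlocks (A B C D : Matrix d d ℂ) :
    blockTangent (Matrix.fromBlocks A B C D) = B + C := rfl

omit [DecidableEq d] in
@[simp] theorem blockWeight_fromBlocks (A B C D : Matrix d d ℂ) :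
    blockWeight (Matrix.fromBlocks A B C D) = D.trace := rfl

theorem blockGen_apply {r : ℕ} (L Lt : Fin r → Matrix d d ℂ) (A B C D : Matrix d d ℂ) :
    blockGen L Lt (Matrix.fromBlocks A B C D) = ∑ k, Matrix.fromBlocks
      (L k * A * (L k)ᴴ - (1 / 2 : ℂ) • ((L k)ᴴ * L k * A + A * ((L k)ᴴ * L k)))
      (L k * A * (Lt k)ᴴ + L k * B * (L k)ᴴ - (1 / 2 : ℂ) • ((L k)ᴴ * L k * B + B * ((L k)ᴴ * L k))
        - A * ((Lt k)ᴴ * L k))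
      (Lt k * A * (L k)ᴴ + L k * C * (L k)ᴴ - (1 / 2 : ℂ) • ((L k)ᴴ * L k * C + C * ((L k)ᴴ * L k))
        - (L k)ᴴ * Lt k * A)
      (Lt k * A * (Lt k)ᴴ + L k * C * (Lt k)ᴴ + Lt k * B * (L k)ᴴ + L k * D * (L k)ᴴ
        - (1 / 2 : ℂ) • ((L k)ᴴ * L k * D + D * ((L k)ᴴ * L k))
        - (L k)ᴴ * Lt k * B - C * ((Lt k)ᴴ * L k)) := by
  rw [blockGen, cpGen_apply, Matrix.conjTranspose_sum, Finset.sum_mul, Finset.mul_sum,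
    ← Finset.sum_add_distrib, ← Finset.sum_add_distrib]
  refine Finset.sum_congr rfl fun k _ => ?_
  simp only [Matrix.fromBlocks_conjTranspose, Matrix.fromBlocks_multiply, Matrix.fromBlocks_add,
    Matrix.conjTranspose_smul, Matrix.conjTranspose_neg, Matrix.conjTranspose_mul,
    Matrix.conjTranspose_conjTranspose, Matrix.conjTranspose_zero]
  have hs : star (-(1 / 2 : ℂ)) = -(1 / 2 : ℂ) := by simp
  simp only [hs, zero_mul, mul_zero, add_zero, add_mul, mul_neg, neg_mul, smul_mul_assoc,
    mul_smul_comm, mul_assoc]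
  congr 1 <;> module

variable {N : ℕ} {Ls : Matrix d d ℂ} {γ : Fin N → ℝ} {Ln : Fin N → Matrix d d ℂ} {θ κ : ℝ}
  {r : ℕ} {L Lt : Fin r → Matrix d d ℂ}

theorem IsGauge.blockState_blockGen (hg : IsGauge Ls γ Ln θ κ L Lt)
    (W : Matrix (d ⊕ d) (d ⊕ d) ℂ) :
    blockState (blockGen L Lt W) = generator Ls γ Ln θ (blockState W) := by
  rw [← Matrix.fromBlocks_toBlocks W, blockGen_apply, map_sum, hg.gen]
  rfl

theorem IsGauge.blockTangent_blockGen (hg : IsGauge Ls γ Ln θ κ L Lt)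
    (W : Matrix (d ⊕ d) (d ⊕ d) ℂ) :
    blockTangent (blockGen L Lt W) =
      ((θ + θ : ℝ) : ℂ) • dissipator Ls (blockState W)
        + generator Ls γ Ln θ (blockTangent W) := by
  rw [← Matrix.fromBlocks_toBlocks W, blockGen_apply, map_sum, hg.gen, hg.tangent,
    ← Finset.sum_add_distrib]
  refine Finset.sum_congr rfl fun k _ => ?_
  simp only [blockTangent_fromBlocks, blockState_fromBlocks, mul_add, add_mul]
  module

/-- The lower left entry of the drift is `-Lᴴ Lt` rather than the symmetric `-(Lᴴ Lt + Ltᴴ L) / 2`,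
so that all terms in the off-diagonal blocks cancel under the trace. The price is paid in the field
`tangent` of `IsGauge`, which constrains the gauge. -/
theorem blockWeight_blockGen (W : Matrix (d ⊕ d) (d ⊕ d) ℂ) :
    blockWeight (blockGen L Lt W) = ((∑ k, (Lt k)ᴴ * Lt k) * blockState W).trace := by
  rw [← Matrix.fromBlocks_toBlocks W, blockGen_apply, map_sum, Finset.sum_mul, Matrix.trace_sum]
  refine Finset.sum_congr rfl fun k _ => ?_
  simp only [blockWeight_fromBlocks, blockState_fromBlocks, Matrix.trace_add, Matrix.trace_sub,
    Matrix.trace_smul]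
  generalize W.toBlocks₁₁ = A, W.toBlocks₁₂ = B, W.toBlocks₂₁ = C, W.toBlocks₂₂ = D
  rw [Matrix.trace_mul_cycle (Lt k) A, Matrix.trace_mul_cycle (L k) C,
    Matrix.trace_mul_cycle (Lt k) B, Matrix.trace_mul_cycle (L k) D,
    Matrix.trace_mul_comm C, Matrix.trace_mul_comm D]
  simp only [smul_eq_mul]
  ring

theorem trace_generator (ρ : Matrix d d ℂ) : (generator Ls γ Ln θ ρ).trace = 0 := by
  have h : ∀ K : Matrix d d ℂ, (dissipator K ρ).trace = 0 := fun K => by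
    simp only [dissipator, LinearMap.sub_apply, LinearMap.comp_apply, LinearMap.mulLeft_apply,
      LinearMap.mulRight_apply, LinearMap.smul_apply, LinearMap.add_apply, Matrix.trace_sub,
      Matrix.trace_smul, Matrix.trace_add]
    rw [← mul_assoc, Matrix.trace_mul_cycle, Matrix.trace_mul_comm ρ]
    simp only [smul_eq_mul]
    ring
  simp [generator, LinearMap.sum_apply, Matrix.trace_sum, h]

theorem trace_evolve (t : ℝ) (ρ : Matrix d d ℂ) : (evolve Ls γ Ln θ t ρ).trace = ρ.trace := by
  have h := flow_intertwine (A := generator Ls γ Ln θ) (B := (0 : ℂ →ₗ[ℂ] ℂ))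
    (Matrix.traceLinearMap d ℂ ℂ) (fun v => by simp [trace_generator]) t ρ
  rw [flow_zero_left] at h
  exact h

/-- `W` certifies the derivative `ρ'` at the state `ρ` with a quantum Fisher information at most
`4 w`. -/
structure IsCertificate (ρ ρ' : Matrix d d ℂ) (w : ℝ) (W : Matrix (d ⊕ d) (d ⊕ d) ℂ) : Prop where
  pos : W.PosSemidef
  state : blockState W = ρ
  tangent : blockTangent W = ρ'
  weight : (blockWeight W).re ≤ w

open scoped MatrixOrder in
theorem re_trace_mul_nonneg {A B : Matrix d d ℂ} (hA : A.PosSemidef) (hB : B.PosSemidef) :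
    0 ≤ (A * B).trace.re := by
  obtain ⟨R, rfl⟩ := CStarAlgebra.nonneg_iff_eq_star_mul_self.mp hA.nonneg
  rw [mul_assoc, Matrix.trace_mul_comm, mul_assoc]
  have := (hB.mul_mul_conjTranspose_same R).trace_nonneg
  exact (Complex.le_def.mp (by simpa [Matrix.star_eq_conjTranspose, mul_assoc] using this)).1

omit [Fintype d] [DecidableEq d] in
theorem PosSemidef.blockState {W : Matrix (d ⊕ d) (d ⊕ d) ℂ} (hW : W.PosSemidef) :
    (blockState W).PosSemidef :=
  hW.submatrix Sum.inl

/-- The block semigroup keeps `W` positive and projects onto the joint evolution of state and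
derivative; its weight increases at a rate at most `κ`. -/
theorem IsGauge.certificate_evolve (hg : IsGauge Ls γ Ln θ κ L Lt) {ρ ρ' : Matrix d d ℂ} {w : ℝ}
    {W : Matrix (d ⊕ d) (d ⊕ d) ℂ} (hW : IsCertificate ρ ρ' w W) (hρ : ρ.trace = 1) {t : ℝ}
    (ht : 0 ≤ t) :
    IsCertificate (evolve Ls γ Ln θ t ρ)
      (flow (tangentGen (dissipator Ls) (∑ k, (γ k : ℂ) • dissipator (Ln k)) θ θ) t (ρ, ρ')).2
      (w + κ * t) (flow (blockGen L Lt) t W) := by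
  have hpos : ∀ s, 0 ≤ s → (flow (blockGen L Lt) s W).PosSemidef := fun s hs =>
    posSemidef_flow_cpGen _ _ hs hW.pos
  have hst : ∀ s, blockState (flow (blockGen L Lt) s W) = evolve Ls γ Ln θ s ρ := fun s => by
    rw [flow_intertwine (B := generator Ls γ Ln θ) _ hg.blockState_blockGen, hW.state]
    rfl
  refine ⟨hpos t ht, hst t, ?_, ?_⟩
  · have h := flow_intertwine (A := blockGen L Lt)
      (B := tangentGen (dissipator Ls) (∑ k, (γ k : ℂ) • dissipator (Ln k)) θ θ)
      (blockState.prod blockTangent) (fun v => Prod.ext (hg.blockState_blockGen v)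
        (hg.blockTangent_blockGen v)) t W
    have h2 := congrArg Prod.snd h
    simp only [LinearMap.prod_apply, Function.prod, hW.state, hW.tangent] at h2
    exact h2
  · have hd : ∀ s, HasDerivAt (fun s : ℝ => (blockWeight (flow (blockGen L Lt) s W)).re)
        (((∑ k, (Lt k)ᴴ * Lt k) * evolve Ls γ Ln θ s ρ).trace).re s := fun s => by
      have := hasDerivAt_flow (blockGen L Lt) blockWeight W s
      rw [blockWeight_blockGen, hst] at this
      exact Complex.reCLM.hasFDerivAt.comp_hasDerivAt s this
    -- `κ - ∑ Ltᴴ Lt` and the evolved state are both positive semidefinite, so their product has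
    -- nonnegative trace; the state has trace one.
    have hle : ∀ s, 0 ≤ s →
        (((∑ k, (Lt k)ᴴ * Lt k) * evolve Ls γ Ln θ s ρ).trace).re ≤ κ := fun s hs => by
      have h1 := re_trace_mul_nonneg hg.bound (hst s ▸ PosSemidef.blockState (hpos s hs))
      rw [sub_mul, smul_mul_assoc, one_mul, Matrix.trace_sub, Matrix.trace_smul, trace_evolve,
        hρ] at h1
      simp only [smul_eq_mul, mul_one, Complex.sub_re, Complex.ofReal_re] at h1
      linarith
    have h1 := Convex.image_sub_le_mul_sub_of_deriv_le (convex_Ici (0 : ℝ))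
      (fun s _ => (hd s).continuousAt.continuousWithinAt)
      (fun s _ => (hd s).differentiableAt.differentiableWithinAt) (C := κ)
      (fun s hs => by
        rw [(hd s).deriv]
        exact hle s (interior_subset hs)) 0 Set.self_mem_Ici t ht ht
    have h2 := hW.weight
    simp only [flow_zero_right, one_apply_eq_self] at h1
    linarith

end Block

/-! ### Certificates for the final states of sequential strategies -/

section Strategy

variable {d : Type} [Fintype d] [DecidableEq d]

theorem IsChannel.trace_apply {Φ : Matrix d d ℂ →ₗ[ℂ] Matrix d d ℂ} (hΦ : IsChannel Φ)
    (ρ : Matrix d d ℂ) : (Φ ρ).trace = ρ.trace := by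
  obtain ⟨r, K, hK, h⟩ := hΦ
  rw [h, Matrix.trace_sum]
  rw [Finset.sum_congr rfl fun j _ => Matrix.trace_mul_cycle (K j) ρ (K j)ᴴ, ← Matrix.trace_sum, ← Finset.sum_mul, hK, one_mul]

theorem isChannel_id : IsChannel (LinearMap.id : Matrix d d ℂ →ₗ[ℂ] Matrix d d ℂ) :=
  ⟨1, fun _ => 1, by simp, by simp⟩

/-- Apply the channel to each of the four blocks, that is, with Kraus operators `K ⊕ K`. Trace
preservation keeps the weight, which is why arbitrary `θ`-independent control cannot help beyond the
bound. -/
theorem IsCertificate.channel {ρ ρ' : Matrix d d ℂ} {w : ℝ} {W : Matrix (d ⊕ d) (d ⊕ d) ℂ}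
    (hW : IsCertificate ρ ρ' w W) {Φ : Matrix d d ℂ →ₗ[ℂ] Matrix d d ℂ} (hΦ : IsChannel Φ) :
    ∃ W', IsCertificate (Φ ρ) (Φ ρ') w W' := by
  have htr := hΦ.trace_apply
  obtain ⟨r, K, hK, h⟩ := hΦ
  have hblock : (∑ j, Matrix.fromBlocks (K j) 0 0 (K j) * W * (Matrix.fromBlocks (K j) 0 0 (K j))ᴴ)
      = ∑ j, Matrix.fromBlocks (K j * W.toBlocks₁₁ * (K j)ᴴ) (K j * W.toBlocks₁₂ * (K j)ᴴ)
        (K j * W.toBlocks₂₁ * (K j)ᴴ) (K j * W.toBlocks₂₂ * (K j)ᴴ) := by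
    refine Finset.sum_congr rfl fun j _ => ?_
    nth_rewrite 1 [← Matrix.fromBlocks_toBlocks W]
    simp [Matrix.fromBlocks_conjTranspose, Matrix.fromBlocks_multiply]
  refine ⟨∑ j, Matrix.fromBlocks (K j) 0 0 (K j) * W * (Matrix.fromBlocks (K j) 0 0 (K j))ᴴ,
    Matrix.posSemidef_sum _ fun j _ => hW.pos.mul_mul_conjTranspose_same _, ?_, ?_, ?_⟩
  · rw [hblock, map_sum, h, ← hW.state]
    rfl
  · rw [hblock, map_sum, h, ← hW.tangent]
    refine Finset.sum_congr rfl fun j _ => ?_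
    change _ = K j * (W.toBlocks₁₂ + W.toBlocks₂₁) * (K j)ᴴ
    rw [blockTangent_fromBlocks, mul_add, add_mul]
  · have e : blockWeight (∑ j, Matrix.fromBlocks (K j) 0 0 (K j) * W *
        (Matrix.fromBlocks (K j) 0 0 (K j))ᴴ) = blockWeight W := by
      rw [hblock, map_sum]
      simp only [blockWeight_fromBlocks]
      rw [← Matrix.trace_sum, ← h, htr]
      rfl
    rw [e]
    exact hW.weight

theorem isCertificate_fromBlocks_zero {ρ : Matrix d d ℂ} (hρ : ρ.PosSemidef) :
    IsCertificate ρ 0 0 (Matrix.fromBlocks ρ 0 0 0) := by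
  refine ⟨?_, rfl, by simp, by simp⟩
  have h := hρ.mul_mul_conjTranspose_same (Matrix.fromRows 1 0 : Matrix (d ⊕ d) d ℂ)
  convert h using 1
  ext (i | i) (j | j) <;>
    simp [Matrix.fromRows_mul, Matrix.conjTranspose_fromRows_eq_fromCols_conjTranspose,
      Matrix.mul_fromCols]

theorem HasDerivAt.linearMap_comp {V V' : Type*} [NormedAddCommGroup V] [NormedSpace ℂ V]
    [FiniteDimensional ℂ V] [NormedAddCommGroup V'] [NormedSpace ℂ V'] (S : V →ₗ[ℂ] V')
    {ρ : ℝ → V} {ρ' : V} {θ : ℝ} (h : HasDerivAt ρ ρ' θ) :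
    HasDerivAt (fun s => S (ρ s)) (S ρ') θ :=
  ((LinearMap.toContinuousLinearMap S).restrictScalars ℝ).hasFDerivAt.comp_hasDerivAt θ h

variable {N : ℕ} {Ls : Matrix d d ℂ} {γ : Fin N → ℝ} {Ln : Fin N → Matrix d d ℂ} {θ κ : ℝ}
  {r : ℕ} {L Lt : Fin r → Matrix d d ℂ}

theorem trace_controlledState {C : ℕ → Matrix d d ℂ →ₗ[ℂ] Matrix d d ℂ} (hC : ∀ m, IsChannel (C m))
    (ρ : Matrix d d ℂ) (τ : ℝ) (m : ℕ) :
    (controlledState Ls γ Ln C ρ τ θ m).trace = ρ.trace := by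
  induction m with
  | zero => rfl
  | succ m ih => rw [controlledState, (hC m).trace_apply, trace_evolve, ih]

theorem IsGauge.certificate_controlledState (hg : IsGauge Ls γ Ln θ κ L Lt)
    {C : ℕ → Matrix d d ℂ →ₗ[ℂ] Matrix d d ℂ} (hC : ∀ m, IsChannel (C m)) {ρ : Matrix d d ℂ}
    (hρ : IsDensity ρ) {τ : ℝ} (hτ : 0 ≤ τ) (m : ℕ) :
    ∃ ρ' W, HasDerivAt (fun s => controlledState Ls γ Ln C ρ τ s m) ρ' θ ∧
      IsCertificate (controlledState Ls γ Ln C ρ τ θ m) ρ' (m * (κ * τ)) W := by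
  induction m with
  | zero =>
    refine ⟨0, Matrix.fromBlocks ρ 0 0 0, hasDerivAt_const _ _, ?_⟩
    simpa [controlledState] using isCertificate_fromBlocks_zero hρ.1
  | succ m ih =>
    obtain ⟨ρ', W, hd, hW⟩ := ih
    have h1 := hg.certificate_evolve hW ((trace_controlledState hC ρ τ m).trans hρ.2) hτ
    obtain ⟨W', hW'⟩ := h1.channel (hC m)
    refine ⟨_, W', HasDerivAt.linearMap_comp (C m) (HasDerivAt.flow_quadGen (dissipator Ls)
      (∑ k, (γ k : ℂ) • dissipator (Ln k)) τ hd), ?_⟩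
    have e : ((m + 1 : ℕ) : ℝ) * (κ * τ) = m * (κ * τ) + κ * τ := by push_cast; ring
    rw [e]
    exact hW'

theorem deriv_entries {ρ : ℝ → Matrix d d ℂ} {ρ' : Matrix d d ℂ} (h : HasDerivAt ρ ρ' θ) :
    Matrix.of (fun i j => deriv (fun s => ρ s i j) θ) = ρ' := by
  ext i j
  exact (HasDerivAt.linearMap_comp (Matrix.entryLinearMap ℂ ℂ i j) h).deriv

end Strategy

/-! ### Variational characterisation of the quantum Fisher information -/

section Variational

variable {d : Type} [Fintype d] [DecidableEq d] {ρ ρ' : Matrix d d ℂ} {w : ℝ}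
  {W : Matrix (d ⊕ d) (d ⊕ d) ℂ}

omit [DecidableEq d] in
theorem IsCertificate.posSemidef (hW : IsCertificate ρ ρ' w W) : ρ.PosSemidef :=
  hW.state ▸ PosSemidef.blockState hW.pos

omit [DecidableEq d] in
theorem IsCertificate.isHermitian_tangent (hW : IsCertificate ρ ρ' w W) : ρ'.IsHermitian := by
  have h := hW.pos.isHermitian
  rw [← hW.tangent]
  change (W.toBlocks₁₂ + W.toBlocks₂₁)ᴴ = W.toBlocks₁₂ + W.toBlocks₂₁
  ext i j
  have h1 := h.apply (Sum.inl i) (Sum.inr j)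
  have h2 := h.apply (Sum.inr i) (Sum.inl j)
  simp only [Matrix.conjTranspose_apply, Matrix.add_apply, Matrix.toBlocks₁₂, Matrix.toBlocks₂₁,
    Matrix.of_apply, star_add, h1, h2]
  ring

/-- Sandwiching `W` between the column `(X, -2)` and its adjoint gives a positive semidefinite
matrix of trace `tr (ρ X²) - 2 tr (ρ' X) + 4 tr D`. -/
theorem IsCertificate.variational_le (hW : IsCertificate ρ ρ' w W) {X : Matrix d d ℂ}
    (hX : X.IsHermitian) :
    2 * (ρ' * X).trace.re - (ρ * X * X).trace.re ≤ 4 * w := by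
  have h := (hW.pos.conjTranspose_mul_mul_same
    (Matrix.fromRows X (-(2 : ℂ) • 1) : Matrix (d ⊕ d) d ℂ)).trace_nonneg
  have h2 : (Matrix.fromRows X (-(2 : ℂ) • 1) : Matrix (d ⊕ d) d ℂ)ᴴ * W *
      (Matrix.fromRows X (-(2 : ℂ) • 1) : Matrix (d ⊕ d) d ℂ)
      = X * W.toBlocks₁₁ * X - (2 : ℂ) • (X * W.toBlocks₁₂) - (2 : ℂ) • (W.toBlocks₂₁ * X)
        + (4 : ℂ) • W.toBlocks₂₂ := by
    rw [Matrix.conjTranspose_fromRows_eq_fromCols_conjTranspose]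
    nth_rewrite 1 [← Matrix.fromBlocks_toBlocks W]
    rw [Matrix.fromCols_mul_fromBlocks, Matrix.fromCols_mul_fromRows, hX.eq]
    have hs : star (-(2 : ℂ)) = -2 := by simp
    simp only [Matrix.conjTranspose_smul, hs, Matrix.conjTranspose_one, smul_mul_assoc, one_mul,
      mul_smul_comm, mul_one, add_mul]
    module
  rw [h2] at h
  have h3 := (Complex.le_def.mp h).1
  have e1 : W.toBlocks₁₁ = ρ := hW.state
  have e2 : ρ' = W.toBlocks₁₂ + W.toBlocks₂₁ := hW.tangent.symm
  have e3 : W.toBlocks₂₂.trace.re ≤ w := hW.weight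
  rw [Matrix.trace_add, Matrix.trace_sub, Matrix.trace_sub, Matrix.trace_smul, Matrix.trace_smul,
    Matrix.trace_smul, Matrix.trace_mul_comm X W.toBlocks₁₂, e1, Matrix.trace_mul_cycle,
    Matrix.trace_mul_comm (X * X), ← mul_assoc] at h3
  rw [e2, add_mul, Matrix.trace_add]
  simp at h3 ⊢
  linarith

/-- The matrix `M` in the eigenbasis of `ρ`. -/
def inEigenbasis (h : ρ.IsHermitian) (M : Matrix d d ℂ) : Matrix d d ℂ :=
  (h.eigenvectorUnitary : Matrix d d ℂ)ᴴ * M * (h.eigenvectorUnitary : Matrix d d ℂ)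

theorem eigenvectorUnitary_mul_conjTranspose (h : ρ.IsHermitian) :
    (h.eigenvectorUnitary : Matrix d d ℂ) * (h.eigenvectorUnitary : Matrix d d ℂ)ᴴ = 1 :=
  Unitary.coe_mul_star_self h.eigenvectorUnitary

theorem conjTranspose_mul_eigenvectorUnitary (h : ρ.IsHermitian) :
    (h.eigenvectorUnitary : Matrix d d ℂ)ᴴ * (h.eigenvectorUnitary : Matrix d d ℂ) = 1 :=
  Unitary.coe_star_mul_self h.eigenvectorUnitary

theorem inEigenbasis_mul (h : ρ.IsHermitian) (A B : Matrix d d ℂ) :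
    inEigenbasis h (A * B) = inEigenbasis h A * inEigenbasis h B := by
  have e : inEigenbasis h A * inEigenbasis h B = (h.eigenvectorUnitary : Matrix d d ℂ)ᴴ * A *
      ((h.eigenvectorUnitary : Matrix d d ℂ) * (h.eigenvectorUnitary : Matrix d d ℂ)ᴴ) * B *
      (h.eigenvectorUnitary : Matrix d d ℂ) := by
    simp only [inEigenbasis, mul_assoc]
  rw [e, eigenvectorUnitary_mul_conjTranspose, mul_one, inEigenbasis, mul_assoc _ A B]

theorem trace_inEigenbasis (h : ρ.IsHermitian) (A : Matrix d d ℂ) :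
    (inEigenbasis h A).trace = A.trace := by
  rw [inEigenbasis, Matrix.trace_mul_cycle, eigenvectorUnitary_mul_conjTranspose, one_mul]

theorem inEigenbasis_self (h : ρ.IsHermitian) :
    inEigenbasis h ρ = Matrix.diagonal (fun j => (h.eigenvalues j : ℂ)) := by
  have := h.conjStarAlgAut_star_eigenvectorUnitary
  simpa [Unitary.conjStarAlgAut_apply, inEigenbasis, Matrix.star_eq_conjTranspose,
    Function.comp_def] using this

theorem inEigenbasis_apply (h : ρ.IsHermitian) (M : Matrix d d ℂ) (j k : d) :
    inEigenbasis h M j k =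
      star (⇑(h.eigenvectorBasis j)) ⬝ᵥ (M *ᵥ ⇑(h.eigenvectorBasis k)) := by
  rw [inEigenbasis, mul_assoc]
  simp [Matrix.mul_apply, dotProduct, Matrix.mulVec, Matrix.IsHermitian.eigenvectorUnitary_apply]

theorem isHermitian_inEigenbasis (h : ρ.IsHermitian) {M : Matrix d d ℂ} (hM : M.IsHermitian) :
    (inEigenbasis h M).IsHermitian :=
  Matrix.isHermitian_conjTranspose_mul_mul _ hM

theorem qfi_eq_sum (h : ρ.IsHermitian) (ρ' : Matrix d d ℂ) :
    qfi ρ ρ' = ∑ j, ∑ k, 2 / (h.eigenvalues j + h.eigenvalues k) * ‖inEigenbasis h ρ' j k‖ ^ 2 := by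
  rw [qfi, dif_pos h]
  simp only [inEigenbasis_apply]

theorem variational_eq_sum (h : ρ.IsHermitian) (ρ' : Matrix d d ℂ) {X : Matrix d d ℂ}
    (hX : X.IsHermitian) :
    2 * (ρ' * X).trace.re - (ρ * X * X).trace.re =
      ∑ j, ∑ k, (2 * (inEigenbasis h ρ' j k * star (inEigenbasis h X j k)).re
        - (h.eigenvalues j + h.eigenvalues k) / 2 * ‖inEigenbasis h X j k‖ ^ 2) := by
  have hX' : ∀ j k, inEigenbasis h X j k = star (inEigenbasis h X k j) := fun j k =>
    ((isHermitian_inEigenbasis h hX).apply j k).symm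
  have h1 : (ρ' * X).trace.re =
      ∑ j, ∑ k, (inEigenbasis h ρ' j k * star (inEigenbasis h X j k)).re := by
    rw [← trace_inEigenbasis h, inEigenbasis_mul, Matrix.trace]
    simp only [Matrix.diag_apply, Matrix.mul_apply, Complex.re_sum]
    simp_rw [← hX']
  have h2 : (ρ * X * X).trace.re =
      ∑ j, ∑ k, h.eigenvalues j * ‖inEigenbasis h X j k‖ ^ 2 := by
    rw [← trace_inEigenbasis h, inEigenbasis_mul, inEigenbasis_mul, inEigenbasis_self, Matrix.trace]
    simp only [Matrix.diag_apply, Matrix.mul_apply (M := Matrix.diagonal _ * _),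
      Matrix.diagonal_mul, Complex.re_sum]
    refine Finset.sum_congr rfl fun j _ => Finset.sum_congr rfl fun k _ => ?_
    rw [hX' k j, mul_assoc, RCLike.star_def, Complex.mul_conj, Complex.re_ofReal_mul,
      Complex.ofReal_re, Complex.normSq_eq_norm_sq]
  have h3 : ∑ j, ∑ k, h.eigenvalues j * ‖inEigenbasis h X j k‖ ^ 2 =
      ∑ j, ∑ k, h.eigenvalues k * ‖inEigenbasis h X j k‖ ^ 2 := by
    rw [Finset.sum_comm]
    refine Finset.sum_congr rfl fun j _ => Finset.sum_congr rfl fun k _ => ?_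
    rw [hX' k j, norm_star]
  have h4 : ∑ j, ∑ k, h.eigenvalues j * ‖inEigenbasis h X j k‖ ^ 2 =
      ∑ j, ∑ k, (h.eigenvalues j + h.eigenvalues k) / 2 * ‖inEigenbasis h X j k‖ ^ 2 := by
    have : ∀ a b : ℝ, a = b → a = (a + b) / 2 := fun a b hab => by linarith
    rw [this _ _ h3]
    simp only [← Finset.sum_add_distrib, Finset.sum_div]
    refine Finset.sum_congr rfl fun j _ => Finset.sum_congr rfl fun k _ => ?_
    ring
  rw [h1, h2, h4]
  simp only [Finset.sum_sub_distrib, Finset.mul_sum]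

/-- The value of the variational functional at a rescaling, entry by entry in the eigenbasis of
`ρ`, of the derivative. -/
theorem IsCertificate.sum_rescaled_le (hW : IsCertificate ρ ρ' w W) (h : ρ.IsHermitian)
    (c : d → d → ℝ) (hc : ∀ j k, c j k = c k j) :
    ∑ j, ∑ k, (2 * c j k - (h.eigenvalues j + h.eigenvalues k) / 2 * c j k ^ 2)
      * ‖inEigenbasis h ρ' j k‖ ^ 2 ≤ 4 * w := by
  let Y : Matrix d d ℂ := Matrix.of fun j k => (c j k : ℂ) * inEigenbasis h ρ' j k
  have hY : Y.IsHermitian := by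
    ext j k
    have := (isHermitian_inEigenbasis h hW.isHermitian_tangent).apply j k
    simp [Y, hc k j, ← this]
  let X : Matrix d d ℂ :=
    (h.eigenvectorUnitary : Matrix d d ℂ) * Y * (h.eigenvectorUnitary : Matrix d d ℂ)ᴴ
  have hX : X.IsHermitian := Matrix.isHermitian_mul_mul_conjTranspose _ hY
  have hXY : inEigenbasis h X = Y := by
    have e : inEigenbasis h X = ((h.eigenvectorUnitary : Matrix d d ℂ)ᴴ *
        (h.eigenvectorUnitary : Matrix d d ℂ)) * Y * ((h.eigenvectorUnitary : Matrix d d ℂ)ᴴ *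
        (h.eigenvectorUnitary : Matrix d d ℂ)) := by
      simp only [inEigenbasis, X, mul_assoc]
    rw [e, conjTranspose_mul_eigenvectorUnitary, one_mul, mul_one]
  refine le_trans (le_of_eq ?_) (hW.variational_le hX)
  rw [variational_eq_sum h ρ' hX, hXY]
  refine Finset.sum_congr rfl fun j _ => Finset.sum_congr rfl fun k _ => ?_
  have e : inEigenbasis h ρ' j k * star (Y j k) =
      ((c j k * ‖inEigenbasis h ρ' j k‖ ^ 2 : ℝ) : ℂ) := by
    simp only [Y, Matrix.of_apply, star_mul', RCLike.star_def, Complex.conj_ofReal]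
    rw [mul_left_comm, Complex.mul_conj, Complex.normSq_eq_norm_sq]
    push_cast
    rfl
  rw [e, Complex.ofReal_re]
  simp only [Y, Matrix.of_apply, norm_mul, Complex.norm_real, mul_pow, Real.norm_eq_abs, sq_abs]
  ring

theorem IsCertificate.qfi_le (hW : IsCertificate ρ ρ' w W) : qfi ρ ρ' ≤ 4 * w := by
  have h := hW.posSemidef.isHermitian
  rw [qfi_eq_sum h]
  -- This rescaling gives the symmetric logarithmic derivative, the maximiser of the functional.
  -- Where `p_j + p_k = 0`, the convention `2 / 0 = 0` makes both sides vanish.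
  refine le_trans (le_of_eq ?_) (hW.sum_rescaled_le h
    (fun j k => 2 / (h.eigenvalues j + h.eigenvalues k)) fun j k => by rw [add_comm])
  refine Finset.sum_congr rfl fun j _ => Finset.sum_congr rfl fun k _ => ?_
  congr 1
  rcases eq_or_ne (h.eigenvalues j + h.eigenvalues k) 0 with h0 | h0
  · simp [h0]
  · field_simp
    ring

/-- On such entries the quadratic term of the functional is absent, so a nonzero entry of `ρ'` would
make it unbounded along `c = n`, contradicting the bound `4 w`. -/
theorem IsCertificate.inEigenbasis_eq_zero (hW : IsCertificate ρ ρ' w W) (h : ρ.IsHermitian)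
    {j k : d} (hjk : h.eigenvalues j + h.eigenvalues k = 0) : inEigenbasis h ρ' j k = 0 := by
  by_contra hne
  have hpos : 0 < ‖inEigenbasis h ρ' j k‖ ^ 2 := by positivity
  obtain ⟨n, hn⟩ := exists_nat_gt (4 * w / (2 * ‖inEigenbasis h ρ' j k‖ ^ 2))
  rw [div_lt_iff₀ (by positivity)] at hn
  have h1 := hW.sum_rescaled_le h
    (fun a b => if h.eigenvalues a + h.eigenvalues b = 0 then (n : ℝ) else 0)
    (fun a b => by rw [add_comm])
  have hterm : ∀ a b, 0 ≤ (2 * (if h.eigenvalues a + h.eigenvalues b = 0 then (n : ℝ) else 0)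
      - (h.eigenvalues a + h.eigenvalues b) / 2 *
        (if h.eigenvalues a + h.eigenvalues b = 0 then (n : ℝ) else 0) ^ 2)
      * ‖inEigenbasis h ρ' a b‖ ^ 2 := fun a b => by
    split_ifs with h0
    · rw [h0, zero_div, zero_mul, sub_zero]; positivity
    · simp
  have h2 := (Finset.single_le_sum (fun b _ => hterm j b) (Finset.mem_univ k)).trans
    (Finset.single_le_sum (fun a _ => Finset.sum_nonneg fun b _ => hterm a b)
      (Finset.mem_univ j))
  have h3 := h2.trans h1
  rw [if_pos hjk, hjk] at h3
  linarith

/-- Completing the square entry by entry. The certificate excludes derivatives that `qfi` would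
ignore, namely those with a component where `p_j + p_k = 0`. -/
theorem IsCertificate.le_qfi (hW : IsCertificate ρ ρ' w W) {X : Matrix d d ℂ}
    (hX : X.IsHermitian) : 2 * (ρ' * X).trace.re - (ρ * X * X).trace.re ≤ qfi ρ ρ' := by
  have h := hW.posSemidef.isHermitian
  rw [qfi_eq_sum h, variational_eq_sum h ρ' hX]
  refine Finset.sum_le_sum fun j _ => Finset.sum_le_sum fun k _ => ?_
  have hj := hW.posSemidef.eigenvalues_nonneg j
  have hk := hW.posSemidef.eigenvalues_nonneg k
  set p := h.eigenvalues j + h.eigenvalues k with hp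
  set a := inEigenbasis h ρ' j k with ha
  set x := inEigenbasis h X j k with hx
  have hre : (a * star x).re ≤ ‖a‖ * ‖x‖ :=
    (Complex.re_le_norm _).trans_eq (by rw [norm_mul, norm_star])
  have hp0 : 0 ≤ p := add_nonneg hj hk
  rcases hp0.eq_or_lt with h0 | h0
  · rw [show a = 0 from hW.inEigenbasis_eq_zero h h0.symm, ← h0]
    simp
  · have key : 2 / p * ‖a‖ ^ 2 - (2 * (‖a‖ * ‖x‖) - p / 2 * ‖x‖ ^ 2)
        = 2 / p * (‖a‖ - p / 2 * ‖x‖) ^ 2 := by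
      field_simp
      ring
    have : 0 ≤ 2 / p * (‖a‖ - p / 2 * ‖x‖) ^ 2 := by positivity
    linarith

end Variational

/-! ### Upper bounds from a gauge -/

section Gauge

variable {d : Type} [Fintype d] [DecidableEq d]

theorem dissipator_apply (L ρ : Matrix d d ℂ) :
    dissipator L ρ = L * ρ * Lᴴ - (1 / 2 : ℂ) • (Lᴴ * L * ρ + ρ * (Lᴴ * L)) := by
  simp [dissipator, mul_assoc]

/-- Without noise the plain derivative of `θ Ls` already serves. -/
theorem isGauge_noiseless (Ls : Matrix d d ℂ) {κ : ℝ}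
    (hκ : ((κ : ℂ) • (1 : Matrix d d ℂ) - Lsᴴ * Ls).PosSemidef) (γ : Fin 0 → ℝ)
    (Ln : Fin 0 → Matrix d d ℂ) (θ : ℝ) :
    IsGauge Ls γ Ln θ κ ![(θ : ℂ) • Ls] ![Ls] where
  gen ρ := by
    simp only [generator, Finset.univ_eq_empty, Finset.sum_empty, add_zero, LinearMap.smul_apply,
      dissipator_apply, Fin.sum_univ_one, Matrix.cons_val_zero, Matrix.conjTranspose_smul,
      RCLike.star_def, Complex.conj_ofReal, smul_mul_assoc, mul_smul_comm]
    push_cast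
    module
  tangent ρ := by
    simp only [dissipator_apply, Fin.sum_univ_one, Matrix.cons_val_zero, Matrix.conjTranspose_smul,
      RCLike.star_def, Complex.conj_ofReal, smul_mul_assoc, mul_smul_comm]
    push_cast
    module
  bound := by simpa using hκ

/-- The plain derivatives `(Ls, 0)` are mixed with `(θ Ls, √γ Ln)` by the anti-Hermitian matrix with
off-diagonal entries `x / √γ` and `-x̄ / √γ`. The mixed jump terms cancel between the two operators;
the mixed drift terms cancel because `hx` makes `x Lsᴴ Ln` Hermitian. The second operator
contributes only `θ² ‖x‖² / γ` to the bound. -/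
theorem isGauge_noisy {Ls Ln : Matrix d d ℂ} {γ : ℝ} (hγ : 0 < γ) {x : ℂ} {g : ℝ}
    (hx : x • (Lsᴴ * Ln) = star x • (Lnᴴ * Ls))
    (hg : ((g : ℂ) • (1 : Matrix d d ℂ) - (Ls + x • Ln)ᴴ * (Ls + x • Ln)).PosSemidef)
    (h1 : (1 - Lsᴴ * Ls).PosSemidef) (θ : ℝ) :
    IsGauge Ls ![γ] ![Ln] θ (g + θ ^ 2 * ‖x‖ ^ 2 / γ) ![(θ : ℂ) • Ls, (√γ : ℂ) • Ln]
      ![Ls + x • Ln, (-(star x * θ) / √γ) • Ls] where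
  gen ρ := by
    have hs : (√γ : ℂ) * √γ = γ := by exact_mod_cast Real.mul_self_sqrt hγ.le
    simp only [generator, LinearMap.add_apply, LinearMap.smul_apply,
      dissipator_apply, Fin.sum_univ_one, Fin.sum_univ_two, Matrix.cons_val_zero,
      Matrix.cons_val_one, Matrix.cons_val_fin_one, Matrix.conjTranspose_smul,
      RCLike.star_def, Complex.conj_ofReal, smul_mul_assoc, mul_smul_comm, smul_smul, ← hs]
    push_cast
    module
  tangent ρ := by
    have hs : (√γ : ℂ) ≠ 0 := by exact_mod_cast (Real.sqrt_pos.mpr hγ).ne'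
    have e1 : x • (ρ * (Lsᴴ * Ln)) = star x • (ρ * (Lnᴴ * Ls)) := by
      rw [← mul_smul_comm, hx, mul_smul_comm]
    have e2 : x • (Lsᴴ * Ln * ρ) = star x • (Lnᴴ * Ls * ρ) := by
      rw [← smul_mul_assoc, hx, smul_mul_assoc]
    have c1 : (√γ : ℂ) * (-(star x * θ) / √γ) = -(star x * θ) := by field_simp
    have c2 : (√γ : ℂ) * star (-(star x * θ) / √γ : ℂ) = -(x * θ) := by
      have := congrArg star c1
      simpa [mul_comm] using this
    generalize (-(star x * θ) / √γ : ℂ) = y at c1 c2 ⊢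
    have c3 := (mul_comm y (√γ : ℂ)).trans c1
    have c4 := (mul_comm (star y) (√γ : ℂ)).trans c2
    simp only [dissipator_apply, Fin.sum_univ_two, Matrix.cons_val_zero,
      Matrix.cons_val_one, Matrix.cons_val_fin_one, Matrix.conjTranspose_smul,
      Matrix.conjTranspose_add, mul_add, add_mul, smul_add, smul_mul_assoc, mul_smul_comm,
      smul_smul, c2, c4]
    simp only [RCLike.star_def, Complex.conj_ofReal] at c1 c3 e1 e2 ⊢
    simp only [c1, c3]
    push_cast
    linear_combination (norm := module) (θ : ℂ) • e2 - (θ : ℂ) • e1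
  bound := by
    have hpos : (0 : ℂ) ≤ ((θ ^ 2 * ‖x‖ ^ 2 / γ : ℝ) : ℂ) := by
      rw [Complex.zero_le_real]; positivity
    have h2 := hg.add (h1.smul hpos)
    have hs : (√γ : ℂ) * √γ = γ := by exact_mod_cast Real.mul_self_sqrt hγ.le
    have hy : star (-(star x * θ) / √γ : ℂ) * (-(star x * θ) / √γ) =
        ((θ ^ 2 * ‖x‖ ^ 2 / γ : ℝ) : ℂ) := by
      have hx2 : star x * x = ((‖x‖ ^ 2 : ℝ) : ℂ) := by
        rw [RCLike.star_def, Complex.conj_mul']; push_cast; rfl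
      push_cast at hx2 ⊢
      rw [← hx2, ← hs]
      simp only [star_div₀, star_neg, star_mul', RCLike.star_def, Complex.conj_ofReal, starRingEnd_self_apply]
      ring
    convert h2 using 1
    simp only [Fin.sum_univ_two, Matrix.cons_val_zero, Matrix.cons_val_one,
      Matrix.cons_val_fin_one, Matrix.conjTranspose_smul, smul_mul_assoc, mul_smul_comm, smul_smul,
      mul_comm _ (star (-(star x * θ) / √γ : ℂ)), hy, Complex.ofReal_add]
    module

/-- The growth rate of the quantum Fisher information is at most `4 κ` at signal strength `θ`, with
`κ` tending to `g` as `θ → 0`. -/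
def HasRateBound {N : ℕ} (Ls : Matrix d d ℂ) (γ : Fin N → ℝ) (Ln : Fin N → Matrix d d ℂ) (g : ℝ) :
    Prop :=
  ∃ κ : ℝ → ℝ, Tendsto κ (𝓝[>] 0) (𝓝 g) ∧
    ∀ θ, ∃ (r : ℕ) (L Lt : Fin r → Matrix d d ℂ), IsGauge Ls γ Ln θ (κ θ) L Lt

variable {N : ℕ} {Ls : Matrix d d ℂ} {γ : Fin N → ℝ} {Ln : Fin N → Matrix d d ℂ} {θ κ : ℝ}
  {r : ℕ} {L Lt : Fin r → Matrix d d ℂ}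

omit [DecidableEq d] in
theorem IsUnitVec.isDensity_pureState {ψ : d → ℂ} (hψ : IsUnitVec ψ) : IsDensity (pureState ψ) :=
  ⟨Matrix.posSemidef_vecMulVec_self_star ψ, by
    rw [pureState, Matrix.trace_vecMulVec, dotProduct_comm]; exact hψ⟩

theorem IsGauge.qfiAt_controlledState_le (hg : IsGauge Ls γ Ln θ κ L Lt)
    {C : ℕ → Matrix d d ℂ →ₗ[ℂ] Matrix d d ℂ} (hC : ∀ m, IsChannel (C m)) {ρ : Matrix d d ℂ}
    (hρ : IsDensity ρ) {τ : ℝ} (hτ : 0 ≤ τ) (m : ℕ) :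
    qfiAt (fun s => controlledState Ls γ Ln C ρ τ s m) θ ≤ 4 * (m * (κ * τ)) := by
  obtain ⟨ρ', W, hd, hW⟩ := hg.certificate_controlledState hC hρ hτ m
  rw [qfiAt, deriv_entries hd]
  exact hW.qfi_le

/-- The functional is evaluated at `X = (2/θ) Q`. When the probability of `Q` is proportional to
`θ²`, the factor `2/θ` is its logarithmic derivative. The gauge serves here only to supply a
derivative with a certificate; the value of `κ` plays no role. -/
theorem IsGauge.le_qfiAt_controlledState (hg : IsGauge Ls γ Ln θ κ L Lt)
    {C : ℕ → Matrix d d ℂ →ₗ[ℂ] Matrix d d ℂ} (hC : ∀ m, IsChannel (C m)) {ρ : Matrix d d ℂ}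
    (hρ : IsDensity ρ) {τ : ℝ} (hτ : 0 ≤ τ) (m : ℕ) {Q : Matrix d d ℂ} (hQ : Q.IsHermitian)
    (hQQ : Q * Q = Q) {q : ℂ}
    (hq : HasDerivAt (fun s => (controlledState Ls γ Ln C ρ τ s m * Q).trace) q θ) :
    4 / θ * q.re - 4 / θ ^ 2 * (controlledState Ls γ Ln C ρ τ θ m * Q).trace.re ≤
      qfiAt (fun s => controlledState Ls γ Ln C ρ τ s m) θ := by
  obtain ⟨ρ', W, hd, hW⟩ := hg.certificate_controlledState hC hρ hτ m
  rw [qfiAt, deriv_entries hd]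
  have hX : (((2 / θ : ℝ) : ℂ) • Q).IsHermitian := by
    rw [Matrix.IsHermitian, Matrix.conjTranspose_smul, hQ.eq, RCLike.star_def, Complex.conj_ofReal]
  have h := hW.le_qfi hX
  have hq' : q = (ρ' * Q).trace := hq.unique (HasDerivAt.linearMap_comp
    (Matrix.traceLinearMap d ℂ ℂ ∘ₗ LinearMap.mulRight ℂ Q) hd)
  rw [mul_assoc, smul_mul_smul_comm, hQQ, mul_smul_comm, mul_smul_comm, Matrix.trace_smul,
    Matrix.trace_smul, ← hq', ← Complex.ofReal_mul, smul_eq_mul, smul_eq_mul,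
    Complex.re_ofReal_mul, Complex.re_ofReal_mul] at h
  convert h using 2 <;> ring

theorem controlledState_id_one (ρ : Matrix d d ℂ) (τ θ : ℝ) :
    controlledState Ls γ Ln (fun _ => LinearMap.id) ρ τ θ 1 = evolve Ls γ Ln θ τ ρ := rfl

theorem IsGauge.resetQFI_le (hg : IsGauge Ls γ Ln θ κ L Lt) {ψ : d → ℂ} (hψ : IsUnitVec ψ)
    {T t : ℝ} (hT : 0 < T) (ht : 0 < t) :
    resetQFI T Ls γ Ln ψ θ t ≤ ENNReal.ofReal (4 * T * κ) := by
  refine ENNReal.ofReal_le_ofReal ?_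
  have h := hg.qfiAt_controlledState_le (fun _ => isChannel_id) hψ.isDensity_pureState ht.le 1
  simp only [controlledState_id_one, Nat.cast_one, one_mul] at h
  calc _ ≤ T / t * (4 * (κ * t)) := mul_le_mul_of_nonneg_left h (by positivity)
    _ = _ := by field_simp

theorem measureResetQFI_le {g : ℝ} (hb : HasRateBound Ls γ Ln g) {ψ : d → ℂ} (hψ : IsUnitVec ψ)
    {T : ℝ} (hT : 0 < T) :
    measureResetQFI T Ls γ Ln ψ ≤ ENNReal.ofReal (4 * T * g) := by
  obtain ⟨κ, hκ, hgauge⟩ := hb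
  have h1 : Tendsto (fun θ => ENNReal.ofReal (4 * T * κ θ)) (𝓝[>] 0)
      (𝓝 (ENNReal.ofReal (4 * T * g))) :=
    ENNReal.tendsto_ofReal (hκ.const_mul _)
  rw [← h1.limsup_eq]
  refine limsup_le_limsup (Eventually.of_forall fun θ => ?_)
  obtain ⟨r, L, Lt, hg⟩ := hgauge θ
  refine limsup_le_of_le (h := ?_)
  filter_upwards [self_mem_nhdsWithin] with t ht
  exact hg.resetQFI_le hψ hT ht

end Gauge

/-! ### Lower bounds from a projective measurement -/

section Projective

variable {d : Type} [Fintype d] [DecidableEq d] {N : ℕ} {Ls : Matrix d d ℂ} {γ : Fin N → ℝ}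
  {Ln : Fin N → Matrix d d ℂ}

/-- The projector `Q` detects the state `P` leaving its initial support: the noise does not cause
transitions to first order, and the signal causes them at a rate `g`. -/
structure Detects (Ls : Matrix d d ℂ) (Ln : Fin N → Matrix d d ℂ) (P Q : Matrix d d ℂ) (g : ℝ) :
    Prop where
  isHermitian : Q.IsHermitian
  idem : Q * Q = Q
  left_zero : Q * P = 0
  right_zero : P * Q = 0
  noise : ∀ k, Q * (Ln k * P) = 0
  rate : (Q * (Ls * P * Lsᴴ)).trace = g

variable {P Q : Matrix d d ℂ} {g : ℝ}

/-- The anticommutator terms have `P` next to `Q` under the trace, so only the jump term survives.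
-/
theorem trace_dissipator_mul (hl : Q * P = 0) (hr : P * Q = 0) (K : Matrix d d ℂ) :
    (dissipator K P * Q).trace = (Q * (K * P * Kᴴ)).trace := by
  rw [Matrix.trace_mul_comm, dissipator_apply, mul_sub, Matrix.trace_sub, mul_smul_comm, mul_add,
    Matrix.trace_smul, Matrix.trace_add, Matrix.trace_mul_comm Q (Kᴴ * K * P), mul_assoc _ P Q, hr,
    ← mul_assoc Q P, hl]
  simp

theorem Detects.trace_signal (h : Detects Ls Ln P Q g) :
    (dissipator Ls P * Q).trace = g := by
  rw [trace_dissipator_mul h.left_zero h.right_zero, h.rate]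

theorem Detects.trace_generator (h : Detects Ls Ln P Q g) (θ : ℝ) :
    (generator Ls γ Ln θ P * Q).trace = ((θ ^ 2 * g : ℝ) : ℂ) := by
  have hn : ∀ k, (dissipator (Ln k) P * Q).trace = 0 := fun k => by
    rw [trace_dissipator_mul h.left_zero h.right_zero, ← mul_assoc, h.noise, zero_mul,
      Matrix.trace_zero]
  simp only [generator, LinearMap.add_apply, LinearMap.smul_apply, LinearMap.sum_apply, add_mul,
    Finset.sum_mul, smul_mul_assoc, Matrix.trace_add, Matrix.trace_sum, Matrix.trace_smul, hn,
    h.trace_signal, smul_eq_mul, mul_zero, Finset.sum_const_zero, add_zero, Complex.ofReal_mul]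

variable (Ls γ Ln P Q) in
/-- The probability of detecting a transition after a time `τ`. -/
def clickProb (θ τ : ℝ) : ℂ := (evolve Ls γ Ln θ τ P * Q).trace

variable (Ls γ Ln P Q) in
/-- The derivative of `clickProb` in the parameter. -/
def clickDeriv (θ τ : ℝ) : ℂ :=
  ((flow (tangentGen (dissipator Ls) (∑ k, (γ k : ℂ) • dissipator (Ln k)) θ θ) τ (P, 0)).2
    * Q).trace

theorem hasDerivAt_clickProb (θ τ : ℝ) :
    HasDerivAt (fun s => clickProb Ls γ Ln P Q s τ) (clickDeriv Ls γ Ln P Q θ τ) θ :=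
  HasDerivAt.linearMap_comp (Matrix.traceLinearMap d ℂ ℂ ∘ₗ LinearMap.mulRight ℂ Q)
    (HasDerivAt.flow_quadGen (dissipator Ls) (∑ k, (γ k : ℂ) • dissipator (Ln k)) τ
      (hasDerivAt_const θ P))

theorem Detects.tendsto_clickProb (h : Detects Ls Ln P Q g) (θ : ℝ) :
    Tendsto (fun τ : ℝ => (τ : ℂ)⁻¹ * clickProb Ls γ Ln P Q θ τ) (𝓝[>] 0)
      (𝓝 ((θ ^ 2 * g : ℝ) : ℂ)) := by
  have h1 := (hasDerivAt_flow (generator Ls γ Ln θ)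
    (Matrix.traceLinearMap d ℂ ℂ ∘ₗ LinearMap.mulRight ℂ Q) P 0).tendsto_slope_zero_right
  simp only [flow_zero_right, one_apply_eq_self, LinearMap.comp_apply, LinearMap.mulRight_apply,
    Matrix.traceLinearMap_apply, h.right_zero, h.trace_generator, Matrix.trace_zero, sub_zero,
    zero_add] at h1
  refine h1.congr fun τ => ?_
  rw [← Complex.ofReal_inv, Complex.real_smul]
  rfl

theorem Detects.tendsto_clickDeriv (h : Detects Ls Ln P Q g) (θ : ℝ) :
    Tendsto (fun τ : ℝ => (τ : ℂ)⁻¹ * clickDeriv Ls γ Ln P Q θ τ) (𝓝[>] 0)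
      (𝓝 ((2 * θ * g : ℝ) : ℂ)) := by
  have h1 := (hasDerivAt_flow (tangentGen (dissipator Ls)
    (∑ k, (γ k : ℂ) • dissipator (Ln k)) θ θ)
    ((Matrix.traceLinearMap d ℂ ℂ ∘ₗ LinearMap.mulRight ℂ Q) ∘ₗ LinearMap.snd ℂ _ _)
    (P, 0) 0).tendsto_slope_zero_right
  have e : (tangentGen (dissipator Ls) (∑ k, (γ k : ℂ) • dissipator (Ln k)) θ θ (P, 0)).2
      = ((θ + θ : ℝ) : ℂ) • dissipator Ls P := by
    simp [tangentGen]
  simp only [flow_zero_right, one_apply_eq_self, LinearMap.comp_apply, LinearMap.mulRight_apply,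
    Matrix.traceLinearMap_apply, LinearMap.snd_apply, e, smul_mul_assoc, Matrix.trace_smul,
    h.trace_signal, zero_mul, Matrix.trace_zero, sub_zero, zero_add, smul_eq_mul,
    ← Complex.ofReal_mul, ← two_mul] at h1
  refine h1.congr fun τ => ?_
  rw [← Complex.ofReal_inv, Complex.real_smul]
  rfl

/-- To first order in `t`, the click probability is `θ² g t` and its derivative `2 θ g t`, so the
lower bound per unit time is `8 g - 4 g`. It is independent of `θ`; the second-order effects of the
noise vanish because `t → 0` at fixed `θ`. -/
theorem Detects.le_liminf_resetQFI {ψ : d → ℂ} (h : Detects Ls Ln (pureState ψ) Q g)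
    (hb : HasRateBound Ls γ Ln g) (hψ : IsUnitVec ψ) {T θ : ℝ} (hT : 0 < T) (hθ : 0 < θ) :
    ENNReal.ofReal (4 * T * g) ≤ liminf (fun t => resetQFI T Ls γ Ln ψ θ t) (𝓝[>] 0) := by
  obtain ⟨κ, -, hgauge⟩ := hb
  obtain ⟨r, L, Lt, hg⟩ := hgauge θ
  have h1 := (Complex.continuous_re.tendsto _).comp (h.tendsto_clickProb (γ := γ) θ)
  have h2 := (Complex.continuous_re.tendsto _).comp (h.tendsto_clickDeriv (γ := γ) θ)
  have h3 := ENNReal.tendsto_ofReal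
    (((h2.const_mul (4 / θ)).sub (h1.const_mul (4 / θ ^ 2))).const_mul T)
  have e : T * (4 / θ * ((2 * θ * g : ℝ) : ℂ).re - 4 / θ ^ 2 * ((θ ^ 2 * g : ℝ) : ℂ).re)
      = 4 * T * g := by
    rw [Complex.ofReal_re, Complex.ofReal_re]
    field_simp
    ring
  rw [e] at h3
  rw [← h3.liminf_eq]
  refine liminf_le_liminf ?_
  filter_upwards [self_mem_nhdsWithin] with t ht
  have ht' : (0 : ℝ) < t := ht
  refine ENNReal.ofReal_le_ofReal ?_
  have h4 := hg.le_qfiAt_controlledState (fun _ => isChannel_id) hψ.isDensity_pureState ht'.le 1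
    h.isHermitian h.idem (q := clickDeriv Ls γ Ln (pureState ψ) Q θ t)
    (hasDerivAt_clickProb θ t)
  simp only [Function.comp_apply, ← Complex.ofReal_inv, Complex.re_ofReal_mul]
  calc _ = T / t * (4 / θ * (clickDeriv Ls γ Ln (pureState ψ) Q θ t).re
        - 4 / θ ^ 2 * (clickProb Ls γ Ln (pureState ψ) Q θ t).re) := by field_simp
    _ ≤ _ := mul_le_mul_of_nonneg_left h4 (by positivity)

theorem Detects.hasMeasureResetQFI {ψ : d → ℂ} (h : Detects Ls Ln (pureState ψ) Q g)
    (hb : HasRateBound Ls γ Ln g) (hψ : IsUnitVec ψ) {T : ℝ} (hT : 0 < T) :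
    HasMeasureResetQFI T Ls γ Ln ψ (ENNReal.ofReal (4 * T * g)) := by
  have hlow : ∀ᶠ θ : ℝ in 𝓝[>] 0, ENNReal.ofReal (4 * T * g) ≤
      liminf (fun t => resetQFI T Ls γ Ln ψ θ t) (𝓝[>] 0) := by
    filter_upwards [self_mem_nhdsWithin] with θ hθ
    exact h.le_liminf_resetQFI hb hψ hT hθ
  have hle : ∀ θ : ℝ, liminf (fun t => resetQFI T Ls γ Ln ψ θ t) (𝓝[>] 0) ≤
      limsup (fun t => resetQFI T Ls γ Ln ψ θ t) (𝓝[>] 0) := fun θ => liminf_le_limsup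
  obtain ⟨κ, hκ, hgauge⟩ := hb
  have hup : ∀ θ : ℝ, limsup (fun t => resetQFI T Ls γ Ln ψ θ t) (𝓝[>] 0) ≤
      ENNReal.ofReal (4 * T * κ θ) := fun θ => by
    obtain ⟨r, L, Lt, hg⟩ := hgauge θ
    refine limsup_le_of_le (h := ?_)
    filter_upwards [self_mem_nhdsWithin] with t ht
    exact hg.resetQFI_le hψ hT ht
  have hlim : Tendsto (fun θ => ENNReal.ofReal (4 * T * κ θ)) (𝓝[>] 0)
      (𝓝 (ENNReal.ofReal (4 * T * g))) :=
    ENNReal.tendsto_ofReal (hκ.const_mul _)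
  exact ⟨tendsto_of_tendsto_of_tendsto_of_le_of_le' tendsto_const_nhds hlim
      (hlow.mono fun θ hθ => hθ.trans (hle θ)) (Eventually.of_forall hup),
    tendsto_of_tendsto_of_tendsto_of_le_of_le' tendsto_const_nhds hlim hlow
      (Eventually.of_forall fun θ => (hle θ).trans (hup θ))⟩

theorem HasMeasureResetQFI.eq {T : ℝ} {ψ : d → ℂ} {F : ℝ≥0∞}
    (h : HasMeasureResetQFI T Ls γ Ln ψ F) : measureResetQFI T Ls γ Ln ψ = F :=
  h.1.limsup_eq

end Projective

/-! ### Noiseless ancillae -/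

section Extend

theorem extend_conjTranspose_mul (n : ℕ) (A B : Matrix (Fin 2) (Fin 2) ℂ) :
    (extend n A)ᴴ * extend n B = extend n (Aᴴ * B) := by
  simp [extend, Matrix.conjTranspose_kronecker, ← Matrix.mul_kronecker_mul]

theorem dissipator_extend (n : ℕ) (L A : Matrix (Fin 2) (Fin 2) ℂ) (B : Matrix (Fin n) (Fin n) ℂ) :
    dissipator (extend n L) (A ⊗ₖ B) = dissipator L A ⊗ₖ B := by
  rw [dissipator_apply, dissipator_apply, extend_conjTranspose_mul]
  simp only [extend, Matrix.conjTranspose_kronecker, ← Matrix.mul_kronecker_mul,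
    Matrix.conjTranspose_one, one_mul, mul_one, ← Matrix.add_kronecker, ← Matrix.smul_kronecker]
  ext ⟨i, a⟩ ⟨j, b⟩
  simp only [Matrix.sub_apply, Matrix.kroneckerMap_apply]
  ring

/-- Adjoining an ancilla in the state `B`. -/
def adjoin {n : ℕ} (B : Matrix (Fin n) (Fin n) ℂ) :
    Matrix (Fin 2) (Fin 2) ℂ →ₗ[ℂ] Matrix (Fin 2 × Fin n) (Fin 2 × Fin n) ℂ where
  toFun A := A ⊗ₖ B
  map_add' _ _ := Matrix.add_kronecker _ _ _
  map_smul' _ _ := Matrix.smul_kronecker _ _ _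

/-- `A ↦ A ⊗ B` intertwines the two generators, as the ancilla does not evolve. -/
theorem evolve_extend {N : ℕ} (Ls : Matrix (Fin 2) (Fin 2) ℂ) (γ : Fin N → ℝ)
    (Ln : Fin N → Matrix (Fin 2) (Fin 2) ℂ) (θ τ : ℝ) {n : ℕ} (A : Matrix (Fin 2) (Fin 2) ℂ)
    (B : Matrix (Fin n) (Fin n) ℂ) :
    evolve (extend n Ls) γ (fun k => extend n (Ln k)) θ τ (A ⊗ₖ B) =
      evolve Ls γ Ln θ τ A ⊗ₖ B := by
  refine (flow_intertwine (A := generator Ls γ Ln θ)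
    (B := generator (extend n Ls) γ (fun k => extend n (Ln k)) θ) (adjoin B) (fun v => ?_) τ A).symm
  have h : ∀ L, adjoin B (dissipator L v) = dissipator (extend n L) (adjoin B v) := fun L =>
    (dissipator_extend n L v B).symm
  simp only [generator, LinearMap.add_apply, LinearMap.smul_apply, LinearMap.sum_apply, map_add,
    map_smul, map_sum, h]

/-- A bound as in `HasRateBound` that holds for all ancillae. -/
def HasUniformRateBound {N : ℕ} (Ls : Matrix (Fin 2) (Fin 2) ℂ) (γ : Fin N → ℝ)
    (Ln : Fin N → Matrix (Fin 2) (Fin 2) ℂ) (g : ℝ) : Prop :=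
  ∃ κ : ℝ → ℝ, Tendsto κ (𝓝[>] 0) (𝓝 g) ∧ ∀ n θ, ∃ (r : ℕ)
    (L Lt : Fin r → Matrix (Fin 2 × Fin n) (Fin 2 × Fin n) ℂ),
    IsGauge (extend n Ls) γ (fun k => extend n (Ln k)) θ (κ θ) L Lt

variable {N : ℕ} {Ls : Matrix (Fin 2) (Fin 2) ℂ} {γ : Fin N → ℝ}
  {Ln : Fin N → Matrix (Fin 2) (Fin 2) ℂ} {g : ℝ}

theorem HasUniformRateBound.hasRateBound (h : HasUniformRateBound Ls γ Ln g) (n : ℕ) :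
    HasRateBound (extend n Ls) γ (fun k => extend n (Ln k)) g :=
  let ⟨κ, hκ, hg⟩ := h
  ⟨κ, hκ, hg n⟩

theorem sequentialQFI_le {κ θ T : ℝ} (hT : 0 < T)
    (hg : ∀ n, ∃ (r : ℕ) (L Lt : Fin r → Matrix (Fin 2 × Fin n) (Fin 2 × Fin n) ℂ),
      IsGauge (extend n Ls) γ (fun k => extend n (Ln k)) θ κ L Lt) :
    sequentialQFI T Ls γ Ln θ ≤ ENNReal.ofReal (4 * T * κ) := by
  refine sSup_le ?_
  rintro _ ⟨M, n, ρ, C, hM, hρ, hC, rfl⟩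
  obtain ⟨r, L, Lt, h⟩ := hg n
  refine ENNReal.ofReal_le_ofReal ?_
  have hM' : (0 : ℝ) < M := by exact_mod_cast hM
  refine (h.qfiAt_controlledState_le hC hρ (by positivity) M).trans_eq ?_
  field_simp

end Extend

/-! ### The sequential strategy that records transitions in a flag -/

section Flag

/-- A unit vector orthogonal to a qubit state. -/
def perp (u : Fin 2 → ℂ) : Fin 2 → ℂ := ![-star (u 1), star (u 0)]

theorem pureState_add_pureState_perp {u : Fin 2 → ℂ} (hu : IsUnitVec u) :
    pureState u + pureState (perp u) = 1 := by
  have h : star (u 0) * u 0 + star (u 1) * u 1 = 1 := by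
    simpa [IsUnitVec, dotProduct, Fin.sum_univ_two] using hu
  ext i j
  simp only [Matrix.add_apply, pureState, Matrix.vecMulVec_apply, Pi.star_apply]
  fin_cases i <;> fin_cases j <;> simp [perp] at h ⊢
  · linear_combination h
  · ring
  · ring
  · linear_combination h

theorem IsUnitVec.perp {u : Fin 2 → ℂ} (hu : IsUnitVec u) : IsUnitVec (perp u) := by
  have h : star (u 0) * u 0 + star (u 1) * u 1 = 1 := by
    simpa [IsUnitVec, dotProduct, Fin.sum_univ_two] using hu
  simp [IsUnitVec, LindbladEstimation.perp, dotProduct, Fin.sum_univ_two] at h ⊢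
  linear_combination h

theorem trace_mul_pureState {d : Type} [Fintype d] (A : Matrix d d ℂ) (w : d → ℂ) :
    (A * pureState w).trace = star w ⬝ᵥ (A *ᵥ w) := by
  rw [pureState, Matrix.mul_vecMulVec, Matrix.trace_vecMulVec, dotProduct_comm]

theorem vecMulVec_mul_mul_conjTranspose {d : Type} [Fintype d] (A : Matrix d d ℂ) (u w : d → ℂ) :
    Matrix.vecMulVec u (star w) * A * (Matrix.vecMulVec u (star w))ᴴ =
      (A * pureState w).trace • pureState u := by
  rw [trace_mul_pureState, Matrix.conjTranspose_vecMulVec, star_star, mul_assoc,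
    Matrix.mul_vecMulVec, Matrix.vecMulVec_mul_vecMulVec, pureState, Matrix.vecMulVec_smul]

/-- The Kraus operators of a measurement of whether the qubit is still in the state `u`: if not,
the flag is set; in both cases the qubit is reset to `u`. -/
def flagKraus (u : Fin 2 → ℂ) : Fin 4 → Matrix (Fin 2 × Fin 2) (Fin 2 × Fin 2) ℂ :=
  ![pureState u ⊗ₖ Matrix.single 0 0 1,
    Matrix.vecMulVec u (star (perp u)) ⊗ₖ Matrix.single 1 0 1,
    pureState u ⊗ₖ Matrix.single 1 1 1,
    Matrix.vecMulVec u (star (perp u)) ⊗ₖ Matrix.single 1 1 1]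

/-- The measurement with the Kraus operators `flagKraus u`. -/
def flagChannel (u : Fin 2 → ℂ) :
    Matrix (Fin 2 × Fin 2) (Fin 2 × Fin 2) ℂ →ₗ[ℂ] Matrix (Fin 2 × Fin 2) (Fin 2 × Fin 2) ℂ :=
  ∑ j, LinearMap.mulLeft ℂ (flagKraus u j) ∘ₗ LinearMap.mulRight ℂ (flagKraus u j)ᴴ

theorem flagChannel_apply (u : Fin 2 → ℂ) (ρ : Matrix (Fin 2 × Fin 2) (Fin 2 × Fin 2) ℂ) :
    flagChannel u ρ = ∑ j, flagKraus u j * ρ * (flagKraus u j)ᴴ := by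
  simp [flagChannel, LinearMap.sum_apply, mul_assoc]

theorem isHermitian_pureState {d : Type} [Fintype d] (u : d → ℂ) : (pureState u).IsHermitian :=
  (Matrix.posSemidef_vecMulVec_self_star u).isHermitian

theorem pureState_mul_self {d : Type} [Fintype d] {u : d → ℂ} (hu : IsUnitVec u) :
    pureState u * pureState u = pureState u := by
  rw [pureState, Matrix.vecMulVec_mul_vecMulVec, show star u ⬝ᵥ u = 1 from hu, one_smul]

theorem isChannel_flagChannel {u : Fin 2 → ℂ} (hu : IsUnitVec u) : IsChannel (flagChannel u) := by
  refine ⟨4, flagKraus u, ?_, flagChannel_apply u⟩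
  have h1 : (pureState u)ᴴ * pureState u = pureState u := by
    rw [(isHermitian_pureState u).eq, pureState_mul_self hu]
  have h2 : (Matrix.vecMulVec u (star (perp u)))ᴴ * Matrix.vecMulVec u (star (perp u)) =
      pureState (perp u) := by
    rw [Matrix.conjTranspose_vecMulVec, star_star, Matrix.vecMulVec_mul_vecMulVec,
      show star u ⬝ᵥ u = 1 from hu, one_smul, pureState]
  have h3 : (Matrix.single 0 0 1 + Matrix.single 1 1 1 : Matrix (Fin 2) (Fin 2) ℂ) = 1 := by
    ext i j
    fin_cases i <;> fin_cases j <;> simp [Matrix.single]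
  simp only [Fin.sum_univ_four, flagKraus, Matrix.cons_val, Matrix.conjTranspose_kronecker,
    ← Matrix.mul_kronecker_mul, h1, h2, Matrix.conjTranspose_single, star_one,
    Matrix.single_mul_single_same, mul_one]
  have h4 : (1 : Matrix (Fin 2 × Fin 2) (Fin 2 × Fin 2) ℂ) =
      (pureState u + pureState (perp u)) ⊗ₖ (Matrix.single 0 0 1 + Matrix.single 1 1 1) := by
    rw [pureState_add_pureState_perp hu, h3, Matrix.one_kronecker_one]
  rw [h4]
  simp only [Matrix.add_kronecker, Matrix.kronecker_add]
  abel

theorem flagChannel_unset {u : Fin 2 → ℂ} (hu : IsUnitVec u) (A : Matrix (Fin 2) (Fin 2) ℂ) :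
    flagChannel u (A ⊗ₖ Matrix.single 0 0 1) =
      (A.trace - (A * pureState (perp u)).trace) • pureState u ⊗ₖ Matrix.single 0 0 1
        + (A * pureState (perp u)).trace • pureState u ⊗ₖ Matrix.single 1 1 1 := by
  have h0 : A.trace - (A * pureState (perp u)).trace = (A * pureState u).trace := by
    rw [sub_eq_iff_eq_add, ← Matrix.trace_add, ← mul_add, pureState_add_pureState_perp hu, mul_one]
  have h1 := vecMulVec_mul_mul_conjTranspose A u u
  have h2 := vecMulVec_mul_mul_conjTranspose A u (perp u)
  rw [← pureState] at h1
  rw [flagChannel_apply, h0, flagKraus]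
  generalize Matrix.vecMulVec u (star (perp u)) = V at h2 ⊢
  simp [Fin.sum_univ_four, Matrix.conjTranspose_kronecker, ← Matrix.mul_kronecker_mul,
    h1, h2, Matrix.conjTranspose_single, Matrix.smul_kronecker]

theorem flagChannel_set {u : Fin 2 → ℂ} (hu : IsUnitVec u) (A : Matrix (Fin 2) (Fin 2) ℂ) :
    flagChannel u (A ⊗ₖ Matrix.single 1 1 1) =
      A.trace • pureState u ⊗ₖ Matrix.single 1 1 1 := by
  have h0 : A.trace = (A * pureState u).trace + (A * pureState (perp u)).trace := by
    rw [← Matrix.trace_add, ← mul_add, pureState_add_pureState_perp hu, mul_one]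
  have h1 := vecMulVec_mul_mul_conjTranspose A u u
  have h2 := vecMulVec_mul_mul_conjTranspose A u (perp u)
  rw [← pureState] at h1
  rw [flagChannel_apply, h0, flagKraus]
  generalize Matrix.vecMulVec u (star (perp u)) = V at h2 ⊢
  simp [Fin.sum_univ_four, Matrix.conjTranspose_kronecker, ← Matrix.mul_kronecker_mul,
    h1, h2, Matrix.conjTranspose_single, Matrix.smul_kronecker,
    add_smul]

variable {N : ℕ} {Ls : Matrix (Fin 2) (Fin 2) ℂ} {γ : Fin N → ℝ}
  {Ln : Fin N → Matrix (Fin 2) (Fin 2) ℂ} {g : ℝ}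

/-- The reset to `u` makes the rounds independent trials with click probability `p`. A set flag
stays set, so it is still unset after `m` rounds with probability `(1 - p) ^ m`. -/
theorem controlledState_flagChannel {u : Fin 2 → ℂ} (hu : IsUnitVec u) (τ θ : ℝ) (m : ℕ) :
    controlledState (extend 2 Ls) γ (fun k => extend 2 (Ln k)) (fun _ => flagChannel u)
      (pureState u ⊗ₖ Matrix.single 0 0 1) τ θ m =
      (1 - clickProb Ls γ Ln (pureState u) (pureState (perp u)) θ τ) ^ m •
        pureState u ⊗ₖ Matrix.single 0 0 1
      + (1 - (1 - clickProb Ls γ Ln (pureState u) (pureState (perp u)) θ τ) ^ m) •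
        pureState u ⊗ₖ Matrix.single 1 1 1 := by
  have htr : (evolve Ls γ Ln θ τ (pureState u)).trace = 1 := by
    rw [trace_evolve]; exact hu.isDensity_pureState.2
  induction m with
  | zero => simp [controlledState]
  | succ m ih =>
    rw [controlledState, ih, map_add, map_smul, map_smul, evolve_extend, evolve_extend, map_add,
      map_smul, map_smul, flagChannel_unset hu, flagChannel_set hu, htr, ← clickProb]
    generalize clickProb Ls γ Ln (pureState u) (pureState (perp u)) θ τ = p
    generalize pureState u ⊗ₖ Matrix.single 0 0 1 = E
    generalize pureState u ⊗ₖ Matrix.single 1 1 1 = F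
    match_scalars <;> ring

/-- The tested projector is the set flag, of probability `1 - (1 - p) ^ M`. Writing `M = k + 1`
ensures `M ≥ 1` and gives the exponent `k` in the derivative. -/
theorem le_sequentialQFI (hb : HasUniformRateBound Ls γ Ln g) {u : Fin 2 → ℂ} (hu : IsUnitVec u)
    {T : ℝ} (hT : 0 < T) (θ : ℝ) (k : ℕ) :
    ENNReal.ofReal (4 / θ * ((k + 1 : ℕ) *
        (1 - clickProb Ls γ Ln (pureState u) (pureState (perp u)) θ (T / (k + 1 : ℕ))) ^ k *
        clickDeriv Ls γ Ln (pureState u) (pureState (perp u)) θ (T / (k + 1 : ℕ))).re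
      - 4 / θ ^ 2 * (1 - (1 - clickProb Ls γ Ln (pureState u) (pureState (perp u)) θ
        (T / (k + 1 : ℕ))) ^ (k + 1)).re) ≤ sequentialQFI T Ls γ Ln θ := by
  obtain ⟨κ, -, hgauge⟩ := hb
  obtain ⟨r, L, Lt, hg⟩ := hgauge 2 θ
  have hρ : IsDensity (pureState u ⊗ₖ Matrix.single 0 0 1 :
      Matrix (Fin 2 × Fin 2) (Fin 2 × Fin 2) ℂ) := by
    have hE : (Matrix.single 0 0 1 : Matrix (Fin 2) (Fin 2) ℂ).PosSemidef := by
      have := Matrix.posSemidef_vecMulVec_self_star (Pi.single 0 1 : Fin 2 → ℂ)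
      convert this using 1
      ext i j
      fin_cases i <;> fin_cases j <;> simp [Matrix.single, Matrix.vecMulVec_apply]
    refine ⟨hu.isDensity_pureState.1.kronecker hE, ?_⟩
    · rw [Matrix.trace_kronecker, hu.isDensity_pureState.2]
      simp
  refine le_trans ?_ (le_sSup ⟨k + 1, 2, _, fun _ => flagChannel u, k.succ_pos, hρ,
    fun _ => isChannel_flagChannel hu, rfl⟩)
  refine ENNReal.ofReal_le_ofReal ?_
  set τ := T / ((k + 1 : ℕ) : ℝ) with hτ
  let Q : Matrix (Fin 2 × Fin 2) (Fin 2 × Fin 2) ℂ := 1 ⊗ₖ Matrix.single 1 1 1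
  have hQ : Q.IsHermitian := by
    simp [Q, Matrix.IsHermitian, Matrix.conjTranspose_kronecker, Matrix.conjTranspose_single]
  have hQQ : Q * Q = Q := by
    simp [Q, ← Matrix.mul_kronecker_mul]
  have htr : ∀ s, (controlledState (extend 2 Ls) γ (fun k => extend 2 (Ln k))
      (fun _ => flagChannel u) (pureState u ⊗ₖ Matrix.single 0 0 1) τ s (k + 1) * Q).trace =
      1 - (1 - clickProb Ls γ Ln (pureState u) (pureState (perp u)) s τ) ^ (k + 1) := fun s => by
    rw [controlledState_flagChannel hu]
    simp [Q, add_mul, ← Matrix.mul_kronecker_mul, Matrix.trace_kronecker,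
      hu.isDensity_pureState.2]
  have hd : HasDerivAt (fun s => (controlledState (extend 2 Ls) γ (fun k => extend 2 (Ln k))
      (fun _ => flagChannel u) (pureState u ⊗ₖ Matrix.single 0 0 1) τ s (k + 1) * Q).trace)
      ((k + 1 : ℕ) * (1 - clickProb Ls γ Ln (pureState u) (pureState (perp u)) θ τ) ^ k *
        clickDeriv Ls γ Ln (pureState u) (pureState (perp u)) θ τ) θ := by
    simp_rw [htr]
    have h1 := ((hasDerivAt_clickProb (Ls := Ls) (γ := γ) (Ln := Ln) (P := pureState u)
      (Q := pureState (perp u)) θ τ).const_sub 1).pow (k + 1) |>.const_sub 1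
    simpa using h1
  have h := hg.le_qfiAt_controlledState (fun _ => isChannel_flagChannel hu) hρ
    (by positivity : 0 ≤ τ) (k + 1) hQ hQQ hd
  rwa [htr] at h

/-- Let `M → ∞` at fixed `θ`: `M p → T θ² g`, the derivative times `M` tends to `2 T θ g`, and `(1 -
p) ^ M → exp (-T θ² g)`, a Poisson limit. The supremum dominates every member of the sequence and
hence the limit. -/
theorem le_sequentialQFI_of_detects (hb : HasUniformRateBound Ls γ Ln g) {u : Fin 2 → ℂ}
    (hu : IsUnitVec u) (hdet : Detects Ls Ln (pureState u) (pureState (perp u)) g)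
    {T θ : ℝ} (hT : 0 < T) (hθ : 0 < θ) :
    ENNReal.ofReal (8 * T * g * Real.exp (-(T * θ ^ 2 * g)) - 4 * T * g) ≤
      sequentialQFI T Ls γ Ln θ := by
  have hτ : Tendsto (fun k : ℕ => T / ((k + 1 : ℕ) : ℝ)) atTop (𝓝[>] 0) := by
    refine tendsto_nhdsWithin_iff.mpr
      ⟨(tendsto_add_atTop_iff_nat 1).mpr (tendsto_const_div_atTop_nhds_zero_nat T), ?_⟩
    exact Eventually.of_forall fun k => by
      have : (0 : ℝ) < (k + 1 : ℕ) := by exact_mod_cast k.succ_pos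
      exact div_pos hT this
  let p : ℕ → ℂ := fun k =>
    clickProb Ls γ Ln (pureState u) (pureState (perp u)) θ (T / (k + 1 : ℕ))
  let q : ℕ → ℂ := fun k =>
    clickDeriv Ls γ Ln (pureState u) (pureState (perp u)) θ (T / (k + 1 : ℕ))
  have hk : ∀ k : ℕ, ((k + 1 : ℕ) : ℂ) ≠ 0 := fun k => by exact_mod_cast k.succ_ne_zero
  have hTC : (T : ℂ) ≠ 0 := by exact_mod_cast hT.ne'
  have hp : Tendsto (fun k : ℕ => ((k + 1 : ℕ) : ℂ) * p k) atTop
      (𝓝 ((T * θ ^ 2 * g : ℝ) : ℂ)) := by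
    have h1 := ((hdet.tendsto_clickProb (γ := γ) θ).comp hτ).const_mul (T : ℂ)
    convert h1 using 2
    · simp only [Function.comp_apply, p]
      have := hk ‹_›
      push_cast at this ⊢
      field_simp
    · push_cast; ring
  have hq : Tendsto (fun k : ℕ => ((k + 1 : ℕ) : ℂ) * q k) atTop
      (𝓝 ((2 * T * θ * g : ℝ) : ℂ)) := by
    have h1 := ((hdet.tendsto_clickDeriv (γ := γ) θ).comp hτ).const_mul (T : ℂ)
    convert h1 using 2
    · simp only [Function.comp_apply, q]
      have := hk ‹_›
      push_cast at this ⊢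
      field_simp
    · push_cast; ring
  have hp0 : Tendsto p atTop (𝓝 0) := by
    have h1 := hp.mul ((tendsto_add_atTop_iff_nat 1).mpr
      (tendsto_inv_atTop_nhds_zero_nat (𝕜 := ℂ)))
    rw [mul_zero] at h1
    refine h1.congr fun k => ?_
    have := hk k
    field_simp
  have hpow : Tendsto (fun k => (1 - p k) ^ k) atTop
      (𝓝 ((Real.exp (-(T * θ ^ 2 * g)) : ℝ) : ℂ)) := by
    have h1 : Tendsto (fun k : ℕ => (k : ℂ) * (-p k)) atTop
        (𝓝 ((-(T * θ ^ 2 * g) : ℝ) : ℂ)) := by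
      have := (hp.sub hp0).neg
      rw [sub_zero, ← Complex.ofReal_neg] at this
      refine this.congr fun k => ?_
      push_cast
      ring
    have h2 := Complex.tendsto_one_add_pow_exp_of_tendsto h1
    rw [← Complex.ofReal_exp] at h2
    simpa only [← sub_eq_add_neg] using h2
  have hpow1 : Tendsto (fun k => (1 - p k) ^ (k + 1)) atTop
      (𝓝 ((Real.exp (-(T * θ ^ 2 * g)) : ℝ) : ℂ)) := by
    have := hpow.mul (hp0.const_sub 1)
    rw [sub_zero, mul_one] at this
    exact this.congr fun k => (pow_succ _ _).symm
  have hlim := ENNReal.tendsto_ofReal ((((Complex.continuous_re.tendsto _).comp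
      (hq.mul hpow)).const_mul (4 / θ)).sub (((Complex.continuous_re.tendsto _).comp
      (hpow1.const_sub 1)).const_mul (4 / θ ^ 2)))
  refine le_trans (ENNReal.ofReal_le_ofReal ?_)
    (le_of_tendsto hlim (Eventually.of_forall fun k => ?_))
  · rw [← Complex.ofReal_mul, ← Complex.ofReal_one, ← Complex.ofReal_sub, Complex.ofReal_re,
      Complex.ofReal_re]
    -- From `1 - exp (-y) ≤ y` at `y = T θ² g`, the subtracted term is at most `4 T g`.
    have h1 := Real.add_one_le_exp (-(T * θ ^ 2 * g))
    have h2 : 4 / θ ^ 2 * (1 - Real.exp (-(T * θ ^ 2 * g))) ≤ 4 / θ ^ 2 * (T * θ ^ 2 * g) :=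
      mul_le_mul_of_nonneg_left (by linarith) (by positivity)
    have h3 : 4 / θ ^ 2 * (T * θ ^ 2 * g) = 4 * T * g := by field_simp
    have h4 : 4 / θ * (2 * T * θ * g * Real.exp (-(T * θ ^ 2 * g))) =
        8 * T * g * Real.exp (-(T * θ ^ 2 * g)) := by field_simp; ring
    linarith
  · refine le_trans (le_of_eq ?_) (le_sequentialQFI hb hu hT θ k)
    simp only [Function.comp_apply]
    rw [mul_right_comm]

theorem isOptimalQFI_of_detects (hb : HasUniformRateBound Ls γ Ln g) {u : Fin 2 → ℂ}
    (hu : IsUnitVec u) (hdet : Detects Ls Ln (pureState u) (pureState (perp u)) g)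
    {T : ℝ} (hT : 0 < T) : IsOptimalQFI T Ls γ Ln (ENNReal.ofReal (4 * T * g)) := by
  have hlow : Tendsto (fun θ : ℝ =>
      ENNReal.ofReal (8 * T * g * Real.exp (-(T * θ ^ 2 * g)) - 4 * T * g)) (𝓝[>] 0)
      (𝓝 (ENNReal.ofReal (4 * T * g))) := by
    refine ENNReal.tendsto_ofReal (Tendsto.mono_left ?_ nhdsWithin_le_nhds)
    have : Continuous fun θ : ℝ => 8 * T * g * Real.exp (-(T * θ ^ 2 * g)) - 4 * T * g := by
      fun_prop
    convert this.tendsto 0 using 2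
    simp
    ring
  have hb' := hb
  obtain ⟨κ, hκ, hgauge⟩ := hb
  have hup : Tendsto (fun θ => ENNReal.ofReal (4 * T * κ θ)) (𝓝[>] 0)
      (𝓝 (ENNReal.ofReal (4 * T * g))) :=
    ENNReal.tendsto_ofReal (hκ.const_mul _)
  refine tendsto_of_tendsto_of_tendsto_of_le_of_le' hlow hup ?_
    (Eventually.of_forall fun θ => sequentialQFI_le hT fun n => hgauge n θ)
  filter_upwards [self_mem_nhdsWithin] with θ hθ
  exact le_sequentialQFI_of_detects hb' hu hdet hT hθ

end Flag

/-! ### Detection in terms of state vectors -/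

section Vectors

variable {d : Type} [Fintype d] {N : ℕ} {Ls : Matrix d d ℂ} {Ln : Fin N → Matrix d d ℂ}

theorem pureState_mulVec (w v : d → ℂ) : pureState w *ᵥ v = (star w ⬝ᵥ v) • w := by
  rw [pureState, Matrix.vecMulVec_mulVec]
  ext i
  simp [mul_comm]

theorem detects_of_vectors {ψ : d → ℂ} {Q : Matrix d d ℂ} {g : ℝ} (hQ : Q.IsHermitian)
    (hQQ : Q * Q = Q) (h0 : Q *ᵥ ψ = 0) (hn : ∀ k, Q *ᵥ (Ln k *ᵥ ψ) = 0)
    (hg : star (Ls *ᵥ ψ) ⬝ᵥ (Q *ᵥ (Ls *ᵥ ψ)) = g) : Detects Ls Ln (pureState ψ) Q g where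
  isHermitian := hQ
  idem := hQQ
  left_zero := by rw [pureState, Matrix.mul_vecMulVec, h0, Matrix.zero_vecMulVec]
  right_zero := by
    have : Q * pureState ψ = 0 := by rw [pureState, Matrix.mul_vecMulVec, h0, Matrix.zero_vecMulVec]
    have h := congrArg Matrix.conjTranspose this
    rwa [Matrix.conjTranspose_mul, hQ.eq, (isHermitian_pureState ψ).eq,
      Matrix.conjTranspose_zero] at h
  noise k := by
    rw [pureState, Matrix.mul_vecMulVec, Matrix.mul_vecMulVec, hn, Matrix.zero_vecMulVec]
  rate := by
    have e : Ls * pureState ψ * Lsᴴ = pureState (Ls *ᵥ ψ) := by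
      rw [pureState, pureState, Matrix.mul_vecMulVec, Matrix.vecMulVec_mul, Matrix.star_mulVec]
    rw [e, trace_mul_pureState, hg]

theorem star_perp_dotProduct (u : Fin 2 → ℂ) : star (perp u) ⬝ᵥ u = 0 := by
  simp [perp, dotProduct, Fin.sum_univ_two]
  ring

/-- The tensor product of two state vectors. -/
def tensorVec {n : ℕ} (u : Fin 2 → ℂ) (e : Fin n → ℂ) : Fin 2 × Fin n → ℂ := fun p => u p.1 * e p.2

theorem kronecker_mulVec_tensorVec {n : ℕ} (A : Matrix (Fin 2) (Fin 2) ℂ)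
    (B : Matrix (Fin n) (Fin n) ℂ) (u : Fin 2 → ℂ) (e : Fin n → ℂ) :
    (A ⊗ₖ B) *ᵥ tensorVec u e = tensorVec (A *ᵥ u) (B *ᵥ e) := by
  ext ⟨i, a⟩
  simp only [Matrix.mulVec, dotProduct, tensorVec, Matrix.kroneckerMap_apply,
    Fintype.sum_prod_type, Finset.sum_mul_sum]
  exact Finset.sum_congr rfl fun _ _ => Finset.sum_congr rfl fun _ _ => by ring

theorem star_tensorVec_dotProduct {n : ℕ} (u v : Fin 2 → ℂ) (e f : Fin n → ℂ) :
    star (tensorVec u e) ⬝ᵥ tensorVec v f = (star u ⬝ᵥ v) * (star e ⬝ᵥ f) := by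
  simp only [dotProduct, tensorVec, Fintype.sum_prod_type, Finset.sum_mul_sum, Pi.star_apply,
    star_mul']
  exact Finset.sum_congr rfl fun _ _ => Finset.sum_congr rfl fun _ _ => by ring

theorem smul_tensorVec {n : ℕ} (a : ℂ) (u : Fin 2 → ℂ) (e : Fin n → ℂ) :
    tensorVec (a • u) e = a • tensorVec u e := by
  ext p
  simp [tensorVec, mul_assoc]

@[simp] theorem tensorVec_zero {n : ℕ} (u : Fin 2 → ℂ) : tensorVec u (0 : Fin n → ℂ) = 0 := by
  ext p
  simp [tensorVec]

theorem detects_perp {N : ℕ} {Ls : Matrix (Fin 2) (Fin 2) ℂ} {Ln : Fin N → Matrix (Fin 2) (Fin 2) ℂ}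
    {u : Fin 2 → ℂ} (hu : IsUnitVec u) (hn : ∀ k, ∃ μ : ℂ, Ln k *ᵥ u = μ • u) {g : ℝ}
    (hg : ‖star (perp u) ⬝ᵥ (Ls *ᵥ u)‖ ^ 2 = g) :
    Detects Ls Ln (pureState u) (pureState (perp u)) g := by
  refine detects_of_vectors (isHermitian_pureState _) (pureState_mul_self hu.perp) ?_
    (fun k => ?_) ?_
  · rw [pureState_mulVec, star_perp_dotProduct, zero_smul]
  · obtain ⟨μ, hμ⟩ := hn k
    rw [hμ, Matrix.mulVec_smul, pureState_mulVec, star_perp_dotProduct, zero_smul, smul_zero]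
  · have e : star (Ls *ᵥ u) ⬝ᵥ perp u = star (star (perp u) ⬝ᵥ (Ls *ᵥ u)) := by
      exact Matrix.star_dotProduct _ _
    rw [pureState_mulVec, dotProduct_smul, smul_eq_mul, e, RCLike.star_def, Complex.mul_conj',
      ← hg, Complex.ofReal_pow]

/-- The orthonormal ancilla states tell which eigenvector is present, so the measurement can test
each branch against its own orthogonal complement. The rates average with weights `‖a₁‖²` and
`‖a₂‖²`; as both equal `g`, so does the average. -/
theorem detects_tensor {N n : ℕ} {Ls : Matrix (Fin 2) (Fin 2) ℂ}
    {Ln : Fin N → Matrix (Fin 2) (Fin 2) ℂ} {u₁ u₂ : Fin 2 → ℂ} {e₁ e₂ : Fin n → ℂ} {a₁ a₂ : ℂ}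
    (hu₁ : IsUnitVec u₁) (hu₂ : IsUnitVec u₂) (hn₁ : ∀ k, ∃ μ : ℂ, Ln k *ᵥ u₁ = μ • u₁)
    (hn₂ : ∀ k, ∃ μ : ℂ, Ln k *ᵥ u₂ = μ • u₂) (he₁ : IsUnitVec e₁) (he₂ : IsUnitVec e₂)
    (he : star e₁ ⬝ᵥ e₂ = 0) (ha : ‖a₁‖ ^ 2 + ‖a₂‖ ^ 2 = 1) {g : ℝ}
    (hg₁ : ‖star (perp u₁) ⬝ᵥ (Ls *ᵥ u₁)‖ ^ 2 = g)
    (hg₂ : ‖star (perp u₂) ⬝ᵥ (Ls *ᵥ u₂)‖ ^ 2 = g) :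
    Detects (extend n Ls) (fun k => extend n (Ln k))
      (pureState (a₁ • tensorVec u₁ e₁ + a₂ • tensorVec u₂ e₂))
      (pureState (perp u₁) ⊗ₖ pureState e₁ + pureState (perp u₂) ⊗ₖ pureState e₂) g := by
  have he' : star e₂ ⬝ᵥ e₁ = 0 := by
    rw [Matrix.star_dotProduct, he, star_zero]
  have hee : pureState e₁ * pureState e₂ = 0 := by
    rw [pureState, pureState, Matrix.vecMulVec_mul_vecMulVec, he, zero_smul, Matrix.vecMulVec_zero]
  have hee' : pureState e₂ * pureState e₁ = 0 := by
    rw [pureState, pureState, Matrix.vecMulVec_mul_vecMulVec, he', zero_smul, Matrix.vecMulVec_zero]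
  have hQ : ∀ v w : Fin 2 → ℂ,
      (pureState (perp u₁) ⊗ₖ pureState e₁ + pureState (perp u₂) ⊗ₖ pureState e₂) *ᵥ
        (a₁ • tensorVec v e₁ + a₂ • tensorVec w e₂) =
      (a₁ * (star (perp u₁) ⬝ᵥ v)) • tensorVec (perp u₁) e₁ +
        (a₂ * (star (perp u₂) ⬝ᵥ w)) • tensorVec (perp u₂) e₂ := fun v w => by
    simp only [Matrix.add_mulVec, Matrix.mulVec_add, Matrix.mulVec_smul,
      kronecker_mulVec_tensorVec, pureState_mulVec, he, he', show star e₁ ⬝ᵥ e₁ = 1 from he₁,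
      show star e₂ ⬝ᵥ e₂ = 1 from he₂, one_smul, zero_smul, tensorVec_zero, add_zero,
      zero_add, smul_tensorVec, smul_smul]
  have hL : ∀ L : Matrix (Fin 2) (Fin 2) ℂ,
      extend n L *ᵥ (a₁ • tensorVec u₁ e₁ + a₂ • tensorVec u₂ e₂) =
        a₁ • tensorVec (L *ᵥ u₁) e₁ + a₂ • tensorVec (L *ᵥ u₂) e₂ := fun L => by
    simp only [extend, Matrix.mulVec_add, Matrix.mulVec_smul, kronecker_mulVec_tensorVec,
      Matrix.one_mulVec]
  refine detects_of_vectors ?_ ?_ ?_ (fun k => ?_) ?_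
  · rw [Matrix.IsHermitian, Matrix.conjTranspose_add, Matrix.conjTranspose_kronecker,
      Matrix.conjTranspose_kronecker, (isHermitian_pureState _).eq, (isHermitian_pureState _).eq,
      (isHermitian_pureState _).eq, (isHermitian_pureState _).eq]
  · simp only [add_mul, mul_add, ← Matrix.mul_kronecker_mul, hee, hee', pureState_mul_self he₁,
      pureState_mul_self he₂, pureState_mul_self hu₁.perp, pureState_mul_self hu₂.perp,
      Matrix.kronecker_zero, add_zero, zero_add]
  · simp only [hQ, star_perp_dotProduct, mul_zero, zero_smul, add_zero]
  · obtain ⟨μ₁, h₁⟩ := hn₁ k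
    obtain ⟨μ₂, h₂⟩ := hn₂ k
    simp only [hL, h₁, h₂, hQ, dotProduct_smul, star_perp_dotProduct, smul_zero, mul_zero,
      zero_smul, add_zero]
  · have e : ∀ u : Fin 2 → ℂ,
        star (Ls *ᵥ u) ⬝ᵥ perp u = star (star (perp u) ⬝ᵥ (Ls *ᵥ u)) := fun u => by
      exact Matrix.star_dotProduct _ _
    rw [hL, hQ]
    simp only [star_add, star_smul, add_dotProduct, dotProduct_add, smul_dotProduct,
      dotProduct_smul, star_tensorVec_dotProduct, he, he', show star e₁ ⬝ᵥ e₁ = 1 from he₁,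
      show star e₂ ⬝ᵥ e₂ = 1 from he₂, mul_zero, add_zero, zero_add, mul_one,
      smul_eq_mul, e]
    generalize star (perp u₁) ⬝ᵥ (Ls *ᵥ u₁) = z₁ at *
    generalize star (perp u₂) ⬝ᵥ (Ls *ᵥ u₂) = z₂ at *
    have hz : ∀ z : ℂ, star z * z = ((‖z‖ ^ 2 : ℝ) : ℂ) := fun z => by
      rw [RCLike.star_def, Complex.conj_mul', Complex.ofReal_pow]
    have ha' : star a₁ * a₁ + star a₂ * a₂ = 1 := by
      rw [hz, hz, ← Complex.ofReal_add, ha, Complex.ofReal_one]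
    have hz₁ := hz z₁
    have hz₂ := hz z₂
    rw [hg₁] at hz₁
    rw [hg₂] at hz₂
    linear_combination star a₁ * a₁ * hz₁ + star a₂ * a₂ * hz₂ + (g : ℂ) * ha'

theorem isUnitVec_tensor {n : ℕ} {u₁ u₂ : Fin 2 → ℂ} {e₁ e₂ : Fin n → ℂ} {a₁ a₂ : ℂ}
    (hu₁ : IsUnitVec u₁) (hu₂ : IsUnitVec u₂) (he₁ : IsUnitVec e₁) (he₂ : IsUnitVec e₂)
    (he : star e₁ ⬝ᵥ e₂ = 0) (ha : ‖a₁‖ ^ 2 + ‖a₂‖ ^ 2 = 1) :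
    IsUnitVec (a₁ • tensorVec u₁ e₁ + a₂ • tensorVec u₂ e₂) := by
  have he' : star e₂ ⬝ᵥ e₁ = 0 := by
    rw [Matrix.star_dotProduct, he, star_zero]
  have hz : ∀ z : ℂ, star z * z = ((‖z‖ ^ 2 : ℝ) : ℂ) := fun z => by
    rw [RCLike.star_def, Complex.conj_mul', Complex.ofReal_pow]
  simp only [IsUnitVec, star_add, star_smul, add_dotProduct, dotProduct_add, smul_dotProduct,
    dotProduct_smul, star_tensorVec_dotProduct, he, he', show star e₁ ⬝ᵥ e₁ = 1 from he₁,
    show star e₂ ⬝ᵥ e₂ = 1 from he₂, show star u₁ ⬝ᵥ u₁ = 1 from hu₁,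
    show star u₂ ⬝ᵥ u₂ = 1 from hu₂, mul_zero, add_zero, zero_add, mul_one,
    smul_eq_mul]
  have ha' : star a₁ * a₁ + star a₂ * a₂ = 1 := by
    rw [hz, hz, ← Complex.ofReal_add, ha, Complex.ofReal_one]
  linear_combination ha'

end Vectors

/-! ### Rate bounds for a qubit with ancillae -/

section Rate

theorem tendsto_noisyRate (γ : ℝ) (x : ℂ) (g : ℝ) :
    Tendsto (fun θ : ℝ => g + θ ^ 2 * ‖x‖ ^ 2 / γ) (𝓝[>] 0) (𝓝 g) := by
  have h : Continuous fun θ : ℝ => g + θ ^ 2 * ‖x‖ ^ 2 / γ := by fun_prop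
  have h0 := (h.tendsto 0).mono_left (nhdsWithin_le_nhds (s := Set.Ioi 0))
  simpa using h0

theorem posSemidef_extend {n : ℕ} {A : Matrix (Fin 2) (Fin 2) ℂ} (hA : A.PosSemidef) :
    (extend n A).PosSemidef :=
  hA.kronecker Matrix.PosSemidef.one

theorem extend_add (n : ℕ) (A B : Matrix (Fin 2) (Fin 2) ℂ) :
    extend n (A + B) = extend n A + extend n B :=
  Matrix.add_kronecker _ _ _

theorem extend_sub (n : ℕ) (A B : Matrix (Fin 2) (Fin 2) ℂ) :
    extend n (A - B) = extend n A - extend n B := by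
  rw [eq_sub_iff_add_eq, ← extend_add, sub_add_cancel]

theorem extend_smul (n : ℕ) (a : ℂ) (A : Matrix (Fin 2) (Fin 2) ℂ) :
    extend n (a • A) = a • extend n A :=
  Matrix.smul_kronecker _ _ _

theorem extend_one (n : ℕ) : extend n 1 = 1 :=
  Matrix.one_kronecker_one

variable {Ls Ln : Matrix (Fin 2) (Fin 2) ℂ} {γ g : ℝ} {x : ℂ}

theorem hasRateBound_noisy (hγ : 0 < γ) (hx : x • (Lsᴴ * Ln) = star x • (Lnᴴ * Ls))
    (hg : ((g : ℂ) • 1 - (Ls + x • Ln)ᴴ * (Ls + x • Ln)).PosSemidef)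
    (h1 : (1 - Lsᴴ * Ls).PosSemidef) : HasRateBound Ls ![γ] ![Ln] g :=
  ⟨_, tendsto_noisyRate γ x g, fun θ => ⟨2, _, _, isGauge_noisy hγ hx hg h1 θ⟩⟩

theorem hasUniformRateBound_noisy (hγ : 0 < γ) (hx : x • (Lsᴴ * Ln) = star x • (Lnᴴ * Ls))
    (hg : ((g : ℂ) • 1 - (Ls + x • Ln)ᴴ * (Ls + x • Ln)).PosSemidef)
    (h1 : (1 - Lsᴴ * Ls).PosSemidef) : HasUniformRateBound Ls ![γ] ![Ln] g := by
  refine ⟨_, tendsto_noisyRate γ x g, fun n θ => ?_⟩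
  have e : (fun k => extend n ((![Ln] : Fin 1 → Matrix (Fin 2) (Fin 2) ℂ) k)) = ![extend n Ln] := by
    ext1 k
    fin_cases k
    rfl
  rw [e]
  refine ⟨2, _, _, isGauge_noisy (x := x) hγ ?_ ?_ ?_ θ⟩
  · rw [extend_conjTranspose_mul, extend_conjTranspose_mul, ← extend_smul, hx, extend_smul]
  · rw [← extend_smul, ← extend_add, extend_conjTranspose_mul, ← extend_one, ← extend_smul,
      ← extend_sub]
    exact posSemidef_extend hg
  · rw [extend_conjTranspose_mul, ← extend_one, ← extend_sub]
    exact posSemidef_extend h1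

theorem hasUniformRateBound_noiseless (hg : ((g : ℂ) • 1 - Lsᴴ * Ls).PosSemidef)
    (γ : Fin 0 → ℝ) (Ln : Fin 0 → Matrix (Fin 2) (Fin 2) ℂ) : HasUniformRateBound Ls γ Ln g := by
  refine ⟨fun _ => g, tendsto_const_nhds, fun n θ => ⟨1, _, _, isGauge_noiseless _ ?_ _ _ θ⟩⟩
  rw [extend_conjTranspose_mul, ← extend_one, ← extend_smul, ← extend_sub]
  exact posSemidef_extend hg

end Rate

/-! ### The in-plane signal and noise operators -/

section InPlane

variable (θ₁ φ : ℝ)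

theorem exp_mul_exp_neg : Complex.exp (Complex.I * φ) * Complex.exp (-(Complex.I * φ)) = 1 := by
  rw [← Complex.exp_add, add_neg_cancel, Complex.exp_zero]

theorem star_exp : star (Complex.exp (Complex.I * φ)) = Complex.exp (-(Complex.I * φ)) := by
  rw [RCLike.star_def, ← Complex.exp_conj]
  simp

theorem star_exp_neg : star (Complex.exp (-(Complex.I * φ))) = Complex.exp (Complex.I * φ) := by
  rw [← star_exp, star_star]

theorem signalOp_eq : signalOp θ₁ φ =
    !![0, (Real.cos θ₁ : ℂ); Real.sin θ₁ * Complex.exp (Complex.I * φ), 0] := by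
  ext i j
  fin_cases i <;> fin_cases j <;> simp [signalOp, sigmaPlus, sigmaMinus]

theorem noiseOp_eq : noiseOp θ₁ φ =
    !![0, Real.sin θ₁ * Complex.exp (-(Complex.I * φ)); -(Real.cos θ₁ : ℂ), 0] := by
  ext i j
  fin_cases i <;> fin_cases j <;> simp [noiseOp, sigmaPlus, sigmaMinus]

/-- The optimal rate of the noisy problem. -/
def noisyRate : ℝ := 1 / (|Real.cos θ₁| + |Real.sin θ₁|) ^ 2

theorem sq_abs_cos_add_abs_sin :
    (|Real.cos θ₁| + |Real.sin θ₁|) ^ 2 = 1 + 2 * |Real.cos θ₁ * Real.sin θ₁| := by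
  rw [add_sq, sq_abs, sq_abs, abs_mul]
  linarith [Real.sin_sq_add_cos_sq θ₁]

theorem abs_cos_add_abs_sin_pos : 0 < |Real.cos θ₁| + |Real.sin θ₁| := by
  have h := sq_abs_cos_add_abs_sin θ₁
  have h1 : 0 ≤ |Real.cos θ₁| + |Real.sin θ₁| := by positivity
  rcases h1.eq_or_lt with h0 | h0
  · rw [← h0] at h
    have := abs_nonneg (Real.cos θ₁ * Real.sin θ₁)
    linarith
  · exact h0

theorem max_sq_eq : max ((Real.cos θ₁ + Real.sin θ₁) ^ 2) ((Real.cos θ₁ - Real.sin θ₁) ^ 2) =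
    (|Real.cos θ₁| + |Real.sin θ₁|) ^ 2 := by
  rw [sq_abs_cos_add_abs_sin]
  have h := Real.sin_sq_add_cos_sq θ₁
  rcases le_total 0 (Real.cos θ₁ * Real.sin θ₁) with h0 | h0
  · rw [abs_of_nonneg h0, max_eq_left (by nlinarith)]
    linarith
  · rw [abs_of_nonpos h0, max_eq_right (by nlinarith)]
    linarith

theorem noisyValue_eq (T : ℝ) : noisyValue T θ₁ = 4 * T * noisyRate θ₁ := by
  rw [noisyValue, max_sq_eq, noisyRate, mul_one_div]

/-- The factor `ξ` solves `c + ξ s = ± (s - ξ c)`, with the plus sign for `c s ≥ 0` and the minus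
sign for `c s ≤ 0`. This choice makes the common modulus `1 / (|c| + |s|)`. -/
theorem exists_optimal_admixture : ∃ ξ : ℝ, (Real.cos θ₁ + ξ * Real.sin θ₁) ^ 2 = noisyRate θ₁ ∧
    (Real.sin θ₁ - ξ * Real.cos θ₁) ^ 2 = noisyRate θ₁ := by
  rw [noisyRate, sq_abs_cos_add_abs_sin]
  have h := Real.sin_sq_add_cos_sq θ₁
  set c := Real.cos θ₁
  set s := Real.sin θ₁
  rcases le_total 0 (c * s) with h0 | h0
  · have hd : (s + c) ^ 2 = 1 + 2 * (c * s) := by linear_combination h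
    have hne : s + c ≠ 0 := fun h1 => by rw [h1] at hd; linarith
    have h1 : c + (s - c) / (s + c) * s = 1 / (s + c) := by
      field_simp
      linear_combination h
    have h2 : s - (s - c) / (s + c) * c = 1 / (s + c) := by
      field_simp
      linear_combination h
    exact ⟨(s - c) / (s + c), by rw [h1, abs_of_nonneg h0, ← hd, div_pow, one_pow],
      by rw [h2, abs_of_nonneg h0, ← hd, div_pow, one_pow]⟩
  · have hd : (c - s) ^ 2 = 1 + 2 * (-(c * s)) := by linear_combination h
    have hne : c - s ≠ 0 := fun h1 => by rw [h1] at hd; linarith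
    have h1 : c + (s + c) / (c - s) * s = 1 / (c - s) := by
      field_simp
      linear_combination h
    have h2 : s - (s + c) / (c - s) * c = -(1 / (c - s)) := by
      field_simp
      linear_combination -h
    exact ⟨(s + c) / (c - s), by rw [h1, abs_of_nonpos h0, ← hd, div_pow, one_pow],
      by rw [h2, abs_of_nonpos h0, ← hd, neg_sq, div_pow, one_pow]⟩

theorem posSemidef_smul_one_sub_signalOp {a : ℝ} (hc : Real.cos θ₁ ^ 2 ≤ a)
    (hs : Real.sin θ₁ ^ 2 ≤ a) :
    ((a : ℂ) • 1 - (signalOp θ₁ φ)ᴴ * signalOp θ₁ φ).PosSemidef := by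
  have e : (a : ℂ) • 1 - (signalOp θ₁ φ)ᴴ * signalOp θ₁ φ =
      Matrix.diagonal ![((a - Real.sin θ₁ ^ 2 : ℝ) : ℂ), ((a - Real.cos θ₁ ^ 2 : ℝ) : ℂ)] := by
    have h1 := exp_mul_exp_neg φ
    have h2 := star_exp φ
    rw [RCLike.star_def] at h2
    rw [signalOp_eq]
    ext i j
    fin_cases i <;> fin_cases j <;>
      simp [Matrix.mul_apply, Fin.sum_univ_two, h2, -Complex.ofReal_sin, -Complex.ofReal_cos]
    · linear_combination (Real.sin θ₁ : ℂ) ^ 2 * h1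
    · ring
  rw [e]
  refine Matrix.PosSemidef.diagonal fun i => ?_
  fin_cases i
  · exact Complex.zero_le_real.mpr (sub_nonneg.mpr hs)
  · exact Complex.zero_le_real.mpr (sub_nonneg.mpr hc)

/-- The product `signalOpᴴ * noiseOp` is diagonal with phase `e^{-iφ}`, which the factor `e^{iφ}`
removes; a real diagonal matrix is Hermitian. -/
theorem signalOp_noiseOp_gauge (ξ : ℝ) :
    (ξ * Complex.exp (Complex.I * φ)) • ((signalOp θ₁ φ)ᴴ * noiseOp θ₁ φ) =
      star (ξ * Complex.exp (Complex.I * φ)) • ((noiseOp θ₁ φ)ᴴ * signalOp θ₁ φ) := by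
  have h1 := exp_mul_exp_neg φ
  have h2 := star_exp φ
  have h3 := star_exp_neg φ
  rw [RCLike.star_def] at h2 h3
  rw [signalOp_eq, noiseOp_eq]
  ext i j
  fin_cases i <;> fin_cases j <;>
    simp [Matrix.mul_apply, Fin.sum_univ_two, h2, h3, -Complex.ofReal_sin, -Complex.ofReal_cos]
  · ring
  · ring

/-- The combined operator is antidiagonal with entries of equal modulus `√g`, so the difference is
in fact zero. -/
theorem posSemidef_noisy {ξ g : ℝ} (h1 : (Real.cos θ₁ + ξ * Real.sin θ₁) ^ 2 = g)
    (h2 : (Real.sin θ₁ - ξ * Real.cos θ₁) ^ 2 = g) :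
    ((g : ℂ) • 1 - (signalOp θ₁ φ + (ξ * Complex.exp (Complex.I * φ)) • noiseOp θ₁ φ)ᴴ *
      (signalOp θ₁ φ + (ξ * Complex.exp (Complex.I * φ)) • noiseOp θ₁ φ)).PosSemidef := by
  have e : (g : ℂ) • 1 - (signalOp θ₁ φ + (ξ * Complex.exp (Complex.I * φ)) • noiseOp θ₁ φ)ᴴ *
      (signalOp θ₁ φ + (ξ * Complex.exp (Complex.I * φ)) • noiseOp θ₁ φ) = 0 := by
    have he := exp_mul_exp_neg φ
    have h3 := star_exp φ
    have h4 := star_exp_neg φ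
    have h1' : ((Real.cos θ₁ : ℂ) + ξ * Real.sin θ₁) ^ 2 = g := by exact_mod_cast h1
    have h2' : ((Real.sin θ₁ : ℂ) - ξ * Real.cos θ₁) ^ 2 = g := by exact_mod_cast h2
    rw [RCLike.star_def] at h3 h4
    have e1 : signalOp θ₁ φ + (ξ * Complex.exp (Complex.I * φ)) • noiseOp θ₁ φ =
        !![0, (Real.cos θ₁ + ξ * Real.sin θ₁ : ℂ);
          (Real.sin θ₁ - ξ * Real.cos θ₁) * Complex.exp (Complex.I * φ), 0] := by
      rw [signalOp_eq, noiseOp_eq]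
      ext i j
      fin_cases i <;> fin_cases j <;> simp [-Complex.ofReal_sin, -Complex.ofReal_cos]
      · linear_combination (ξ * Real.sin θ₁ : ℂ) * he
      · ring
    rw [e1]
    ext i j
    fin_cases i <;> fin_cases j <;>
      simp [Matrix.mul_apply, Fin.sum_univ_two, h3, -Complex.ofReal_sin, -Complex.ofReal_cos]
    · linear_combination -h2' - ((Real.sin θ₁ : ℂ) - ξ * Real.cos θ₁) ^ 2 * he
    · linear_combination -h1'
  rw [e]
  exact Matrix.PosSemidef.zero

variable {γ : ℝ}

theorem hasRateBound_inPlane (hγ : 0 < γ) :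
    HasRateBound (signalOp θ₁ φ) ![γ] ![noiseOp θ₁ φ] (noisyRate θ₁) := by
  obtain ⟨ξ, h1, h2⟩ := exists_optimal_admixture θ₁
  refine hasRateBound_noisy hγ (signalOp_noiseOp_gauge θ₁ φ ξ) (posSemidef_noisy θ₁ φ h1 h2) ?_
  simpa only [Complex.ofReal_one, one_smul] using
    posSemidef_smul_one_sub_signalOp θ₁ φ (Real.cos_sq_le_one θ₁) (Real.sin_sq_le_one θ₁)

theorem hasUniformRateBound_inPlane (hγ : 0 < γ) :
    HasUniformRateBound (signalOp θ₁ φ) ![γ] ![noiseOp θ₁ φ] (noisyRate θ₁) := by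
  obtain ⟨ξ, h1, h2⟩ := exists_optimal_admixture θ₁
  refine hasUniformRateBound_noisy hγ (signalOp_noiseOp_gauge θ₁ φ ξ)
    (posSemidef_noisy θ₁ φ h1 h2) ?_
  simpa only [Complex.ofReal_one, one_smul] using
    posSemidef_smul_one_sub_signalOp θ₁ φ (Real.cos_sq_le_one θ₁) (Real.sin_sq_le_one θ₁)

theorem star_perp_dotProduct_signalOp (u : Fin 2 → ℂ) :
    star (perp u) ⬝ᵥ (signalOp θ₁ φ *ᵥ u) =
      Real.sin θ₁ * Complex.exp (Complex.I * φ) * u 0 ^ 2 - Real.cos θ₁ * u 1 ^ 2 := by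
  rw [signalOp_eq]
  simp [perp, dotProduct, Matrix.mulVec, Fin.sum_univ_two, -Complex.ofReal_sin,
    -Complex.ofReal_cos]
  ring

variable {θ₁ φ}

/-- Let `z` be the signal amplitude from `u` to its complement. The eigenvalue equation says that
the noise amplitude vanishes. Combined with `c² + s² = 1`, this gives `c z = -u₁²` and `s e^{-iφ} z
= u₀²`. Taking norms and adding, `(|c| + |s|) ‖z‖ = ‖u₀‖² + ‖u₁‖² = 1`. The same computation covers
a nilpotent noise operator. -/
theorem IsEigenstate.rate {u : Fin 2 → ℂ} (hu : IsEigenstate (noiseOp θ₁ φ) u) :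
    ‖star (perp u) ⬝ᵥ (signalOp θ₁ φ *ᵥ u)‖ ^ 2 = noisyRate θ₁ := by
  obtain ⟨hu1, μ, hμ⟩ := hu
  have he := exp_mul_exp_neg φ
  have hperp : Real.sin θ₁ * Complex.exp (-(Complex.I * φ)) * u 1 ^ 2 + Real.cos θ₁ * u 0 ^ 2
      = 0 := by
    have h := congrArg (fun v => star (perp u) ⬝ᵥ v) hμ
    simp only [dotProduct_smul, star_perp_dotProduct, smul_zero, noiseOp_eq] at h
    simp [perp, dotProduct, Matrix.mulVec, Fin.sum_univ_two, -Complex.ofReal_sin,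
      -Complex.ofReal_cos] at h
    linear_combination -h
  have hnorm : ‖u 0‖ ^ 2 + ‖u 1‖ ^ 2 = 1 := by
    have h : star (u 0) * u 0 + star (u 1) * u 1 = 1 := by
      simpa [IsUnitVec, dotProduct, Fin.sum_univ_two] using hu1
    rw [RCLike.star_def, Complex.conj_mul', Complex.conj_mul'] at h
    exact_mod_cast h
  rw [star_perp_dotProduct_signalOp]
  have hsq : (Real.sin θ₁ : ℂ) ^ 2 + (Real.cos θ₁ : ℂ) ^ 2 = 1 := by
    exact_mod_cast Real.sin_sq_add_cos_sq θ₁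
  set z := Real.sin θ₁ * Complex.exp (Complex.I * φ) * u 0 ^ 2 - Real.cos θ₁ * u 1 ^ 2 with hz
  have h1 : (Real.cos θ₁ : ℂ) * z = -u 1 ^ 2 := by
    rw [hz]
    linear_combination (Real.sin θ₁ * Complex.exp (Complex.I * φ)) * hperp
      - (Real.sin θ₁ : ℂ) ^ 2 * u 1 ^ 2 * he - u 1 ^ 2 * hsq
  have h2 : (Real.sin θ₁ * Complex.exp (-(Complex.I * φ)) : ℂ) * z = u 0 ^ 2 := by
    rw [hz]
    linear_combination -(Real.cos θ₁ : ℂ) * hperp + (Real.sin θ₁ : ℂ) ^ 2 * u 0 ^ 2 * he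
      + u 0 ^ 2 * hsq
  have hexp : ‖Complex.exp (-(Complex.I * φ))‖ = 1 := by
    rw [show -(Complex.I * φ) = ((-φ : ℝ) : ℂ) * Complex.I by push_cast; ring]
    exact Complex.norm_exp_ofReal_mul_I _
  have h3 := congrArg norm h1
  have h4 := congrArg norm h2
  rw [norm_mul, Complex.norm_real, norm_neg, norm_pow, Real.norm_eq_abs] at h3
  rw [norm_mul, norm_mul, Complex.norm_real, hexp, mul_one, norm_pow, Real.norm_eq_abs] at h4
  have h5 : (|Real.cos θ₁| + |Real.sin θ₁|) * ‖z‖ = 1 := by linarith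
  have hpos := abs_cos_add_abs_sin_pos θ₁
  rw [noisyRate, eq_one_div_of_mul_eq_one_right h5, div_pow, one_pow]

theorem exists_isEigenstate (L : Matrix (Fin 2) (Fin 2) ℂ) : ∃ u, IsEigenstate L u := by
  obtain ⟨μ, hμ⟩ := Module.End.exists_eigenvalue (Matrix.toLin' L)
  obtain ⟨v, hv⟩ := hμ.exists_hasEigenvector
  have h1 : L *ᵥ v = μ • v := by simpa using hv.apply_eq_smul
  have hpos : 0 < ‖v 0‖ ^ 2 + ‖v 1‖ ^ 2 := by
    by_contra hcon
    have h0 : ‖v 0‖ ^ 2 = 0 ∧ ‖v 1‖ ^ 2 = 0 :=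
      ⟨by nlinarith [sq_nonneg ‖v 0‖, sq_nonneg ‖v 1‖], by nlinarith [sq_nonneg ‖v 0‖, sq_nonneg ‖v 1‖]⟩
    refine hv.2 (funext fun i => ?_)
    fin_cases i
    · simpa using h0.1
    · simpa using h0.2
  set r := √(‖v 0‖ ^ 2 + ‖v 1‖ ^ 2) with hr
  have hr0 : (r : ℂ) ≠ 0 := by exact_mod_cast (Real.sqrt_pos.mpr hpos).ne'
  have hrr : (r : ℂ) ^ 2 = ((‖v 0‖ ^ 2 + ‖v 1‖ ^ 2 : ℝ) : ℂ) := by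
    rw [← Real.sq_sqrt hpos.le, Complex.ofReal_pow]
  refine ⟨(r : ℂ)⁻¹ • v, ?_, μ, by rw [Matrix.mulVec_smul, h1, smul_comm]⟩
  have h2 : star v ⬝ᵥ v = (r : ℂ) ^ 2 := by
    rw [hrr]
    simp [dotProduct, Fin.sum_univ_two, Complex.conj_mul']
  rw [IsUnitVec, star_smul, smul_dotProduct, dotProduct_smul, h2, RCLike.star_def, map_inv₀,
    Complex.conj_ofReal, smul_eq_mul, smul_eq_mul]
  field_simp

end InPlane

/-! ### The noiseless optimum and its comparison with the noisy one -/

section Comparison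

variable (θ₁ φ : ℝ)

/-- The optimal rate of the noiseless problem. -/
def noiselessRate : ℝ := max (Real.cos θ₁ ^ 2) (Real.sin θ₁ ^ 2)

theorem noiselessValue_eq (T : ℝ) : noiselessValue T θ₁ = 4 * T * noiselessRate θ₁ := rfl

/-- `signalOpᴴ * signalOp` is diagonal with entries `sin² θ₁` and `cos² θ₁`. The basis vector of the
larger entry is mapped into its orthogonal complement, so all of that rate is detectable. -/
theorem isOptimalQFI_noiseless {T : ℝ} (hT : 0 < T) :
    IsOptimalQFI T (signalOp θ₁ φ) ![] ![] (ENNReal.ofReal (4 * T * noiselessRate θ₁)) := by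
  have hb : HasUniformRateBound (signalOp θ₁ φ) ![] ![] (noiselessRate θ₁) :=
    hasUniformRateBound_noiseless (posSemidef_smul_one_sub_signalOp θ₁ φ (le_max_left _ _)
      (le_max_right _ _)) _ _
  have hexp : ‖Complex.exp (Complex.I * φ)‖ = 1 := by
    rw [mul_comm]
    exact Complex.norm_exp_ofReal_mul_I φ
  rcases le_total (Real.sin θ₁ ^ 2) (Real.cos θ₁ ^ 2) with h | h
  · have hu : IsUnitVec (![0, 1] : Fin 2 → ℂ) := by simp [IsUnitVec, dotProduct]
    refine isOptimalQFI_of_detects hb hu (detects_perp hu (fun k => k.elim0) ?_) hT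
    rw [star_perp_dotProduct_signalOp, noiselessRate, max_eq_left h]
    simp [-Complex.ofReal_cos, Complex.norm_real]
  · have hu : IsUnitVec (![1, 0] : Fin 2 → ℂ) := by simp [IsUnitVec, dotProduct]
    refine isOptimalQFI_of_detects hb hu (detects_perp hu (fun k => k.elim0) ?_) hT
    rw [star_perp_dotProduct_signalOp, noiselessRate, max_eq_right h]
    simp [-Complex.ofReal_sin, Complex.norm_real, hexp]

theorem sin_four_mul_eq_zero_iff : Real.sin (4 * θ₁) = 0 ↔ ∃ k : ℤ, θ₁ = k * Real.pi / 4 := by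
  rw [Real.sin_eq_zero_iff]
  exact exists_congr fun k => ⟨fun h => by linarith, fun h => by linarith⟩

theorem sin_four_mul_eq : Real.sin (4 * θ₁) =
    4 * (Real.cos θ₁ * Real.sin θ₁) * (Real.cos θ₁ ^ 2 - Real.sin θ₁ ^ 2) := by
  rw [show 4 * θ₁ = 2 * (2 * θ₁) by ring, Real.sin_two_mul, Real.sin_two_mul, Real.cos_two_mul']
  ring

/-- With `m² + l² = 1` one has `m (m + l) - 1 = l (m - l)`, so the difference of squares `m² (m +
l)² - 1` factors through `l (m - l)`. Here `m` and `l` are the larger and the smaller of `|cos θ₁|`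
and `|sin θ₁|`. -/
theorem one_div_add_sq_compare {m l : ℝ} (hl : 0 ≤ l) (hlm : l ≤ m) (h : m ^ 2 + l ^ 2 = 1) :
    (l * (m - l) = 0 → 1 / (m + l) ^ 2 = m ^ 2) ∧ (l * (m - l) ≠ 0 → 1 / (m + l) ^ 2 < m ^ 2) := by
  have hm : 0 < m := by
    by_contra hm
    have h1 : m = 0 := le_antisymm (not_lt.mp hm) (hl.trans hlm)
    have h2 : l = 0 := le_antisymm (hlm.trans_eq h1) hl
    rw [h1, h2] at h
    norm_num at h
  have hpos : 0 < (m + l) ^ 2 := by positivity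
  have key : m ^ 2 * (m + l) ^ 2 - 1 = l * (m - l) * (m * (m + l) + 1) := by
    linear_combination (m * (m + l) + 1) * h
  refine ⟨fun h0 => ?_, fun h0 => ?_⟩
  · rw [h0, zero_mul, sub_eq_zero] at key
    rw [div_eq_iff hpos.ne', key]
  · have h1 : 0 < l * (m - l) := lt_of_le_of_ne (mul_nonneg hl (sub_nonneg.mpr hlm)) h0.symm
    have h2 : 0 < l * (m - l) * (m * (m + l) + 1) := by positivity
    rw [div_lt_iff₀ hpos]
    linarith

theorem noisyRate_compare :
    ((∃ k : ℤ, θ₁ = k * Real.pi / 4) → noisyRate θ₁ = noiselessRate θ₁) ∧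
      ((¬ ∃ k : ℤ, θ₁ = k * Real.pi / 4) → noisyRate θ₁ < noiselessRate θ₁) := by
  have h : |Real.cos θ₁| ^ 2 + |Real.sin θ₁| ^ 2 = 1 := by
    rw [sq_abs, sq_abs]
    exact Real.cos_sq_add_sin_sq θ₁
  have hpos := abs_cos_add_abs_sin_pos θ₁
  -- The exceptional angles are the zeros of `sin 4θ₁ = 4 c s (c² - s²)`. Absolute values reduce
  -- this to `|c|` and `|s|`, where it vanishes exactly when the smaller is zero or the two agree.
  rw [← sin_four_mul_eq_zero_iff, sin_four_mul_eq, ← abs_eq_zero, abs_mul, abs_mul, abs_mul,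
    ← sq_abs (Real.cos θ₁), ← sq_abs (Real.sin θ₁), noisyRate, noiselessRate,
    ← sq_abs (Real.cos θ₁), ← sq_abs (Real.sin θ₁), sq_sub_sq, abs_mul, abs_of_pos hpos,
    abs_of_pos (four_pos : (0 : ℝ) < 4)]
  have hc := abs_nonneg (Real.cos θ₁)
  have hs := abs_nonneg (Real.sin θ₁)
  generalize |Real.cos θ₁| = a at *
  generalize |Real.sin θ₁| = b at *
  have key : 4 * (a * b) * ((a + b) * |a - b|) = 0 ↔ min a b * (max a b - min a b) = 0 := by
    have hmax : max a b ≠ 0 := fun h0 => by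
      have h1 := (le_max_left a b).trans_eq h0
      have h2 := (le_max_right a b).trans_eq h0
      linarith
    rw [max_sub_min_eq_abs, abs_sub_comm b a, ← min_mul_max a b]
    simp only [mul_eq_zero, hpos.ne', hmax, OfNat.ofNat_ne_zero, false_or, or_false]
  have hmm : max a b ^ 2 + min a b ^ 2 = 1 := by
    rcases le_total a b with hab | hab
    · rw [max_eq_right hab, min_eq_left hab]; linarith
    · rw [max_eq_left hab, min_eq_right hab]; linarith
  have hmax : max (a ^ 2) (b ^ 2) = max a b ^ 2 := by
    rcases le_total a b with hab | hab
    · rw [max_eq_right hab, max_eq_right (pow_le_pow_left₀ hc hab 2)]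
    · rw [max_eq_left hab, max_eq_left (pow_le_pow_left₀ hs hab 2)]
  have hcmp := one_div_add_sq_compare (le_min hc hs) min_le_max hmm
  rw [max_add_min] at hcmp
  rw [hmax]
  simp only [key]
  exact hcmp

end Comparison

end LindbladEstimation

end

open LindbladEstimation in
theorem mainTheorem10 (T : ℝ) (hT : 0 < T) (γ₂ : ℝ) (hγ₂ : 0 < γ₂) (θ₁ φ : ℝ) :
    -- the optimal noisy quantum Fisher information, with fast and precise control and ancillae
    LindbladEstimation.IsOptimalQFI T (LindbladEstimation.signalOp θ₁ φ)
      ![γ₂] ![LindbladEstimation.noiseOp θ₁ φ]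
      (ENNReal.ofReal (LindbladEstimation.noisyValue T θ₁)) ∧
    -- every eigenstate of the noise operator attains it
    (∀ u : Fin 2 → ℂ, LindbladEstimation.IsEigenstate (LindbladEstimation.noiseOp θ₁ φ) u →
      LindbladEstimation.HasMeasureResetQFI T (LindbladEstimation.signalOp θ₁ φ)
        ![γ₂] ![LindbladEstimation.noiseOp θ₁ φ] u
        (ENNReal.ofReal (LindbladEstimation.noisyValue T θ₁))) ∧
    -- so does every `a₁ |u₁, e₁⟩ + a₂ |u₂, e₂⟩` with eigenstates `u₁`, `u₂` and orthonormal `e₁`, `e₂`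
    (∀ (n : ℕ) (u₁ u₂ : Fin 2 → ℂ) (e₁ e₂ : Fin n → ℂ) (a₁ a₂ : ℂ),
      LindbladEstimation.IsEigenstate (LindbladEstimation.noiseOp θ₁ φ) u₁ →
      LindbladEstimation.IsEigenstate (LindbladEstimation.noiseOp θ₁ φ) u₂ →
      LindbladEstimation.IsUnitVec e₁ → LindbladEstimation.IsUnitVec e₂ →
      dotProduct (star e₁) e₂ = 0 → ‖a₁‖ ^ 2 + ‖a₂‖ ^ 2 = 1 →
      LindbladEstimation.HasMeasureResetQFI T
        (LindbladEstimation.extend n (LindbladEstimation.signalOp θ₁ φ)) ![γ₂]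
        (fun k => LindbladEstimation.extend n (![LindbladEstimation.noiseOp θ₁ φ] k))
        (fun p => a₁ * (u₁ p.1 * e₁ p.2) + a₂ * (u₂ p.1 * e₂ p.2))
        (ENNReal.ofReal (LindbladEstimation.noisyValue T θ₁))) ∧
    -- there is no gap between the extended and the unextended optimum
    LindbladEstimation.IsOptimalExtendedQFI T (LindbladEstimation.signalOp θ₁ φ)
      ![γ₂] ![LindbladEstimation.noiseOp θ₁ φ]
      (ENNReal.ofReal (LindbladEstimation.noisyValue T θ₁)) ∧
    LindbladEstimation.IsOptimalUnextendedQFI T (LindbladEstimation.signalOp θ₁ φ)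
      ![γ₂] ![LindbladEstimation.noiseOp θ₁ φ]
      (ENNReal.ofReal (LindbladEstimation.noisyValue T θ₁)) ∧
    -- the optimal noiseless quantum Fisher information, and the comparison with the noisy one
    LindbladEstimation.IsOptimalQFI T (LindbladEstimation.signalOp θ₁ φ) ![] ![]
      (ENNReal.ofReal (LindbladEstimation.noiselessValue T θ₁)) ∧
    ((∃ k : ℤ, θ₁ = k * Real.pi / 4) →
      LindbladEstimation.noisyValue T θ₁ = LindbladEstimation.noiselessValue T θ₁) ∧
    ((¬ ∃ k : ℤ, θ₁ = k * Real.pi / 4) →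
      LindbladEstimation.noisyValue T θ₁ < LindbladEstimation.noiselessValue T θ₁) := by
  have hev : ∀ u : Fin 2 → ℂ, IsEigenstate (noiseOp θ₁ φ) u →
      ∀ k, ∃ μ : ℂ, (![noiseOp θ₁ φ] : Fin 1 → _) k *ᵥ u = μ • u := by
    rintro u ⟨-, μ, hμ⟩ k
    fin_cases k
    exact ⟨μ, hμ⟩
  have hb := hasRateBound_inPlane θ₁ φ hγ₂
  have hub := hasUniformRateBound_inPlane θ₁ φ hγ₂
  have hreset : ∀ u : Fin 2 → ℂ, IsEigenstate (noiseOp θ₁ φ) u →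
      HasMeasureResetQFI T (signalOp θ₁ φ) ![γ₂] ![noiseOp θ₁ φ] u
        (ENNReal.ofReal (4 * T * noisyRate θ₁)) := fun u hu =>
    (detects_perp hu.1 (hev u hu) hu.rate).hasMeasureResetQFI hb hu.1 hT
  have hext : ∀ (n : ℕ) (u₁ u₂ : Fin 2 → ℂ) (e₁ e₂ : Fin n → ℂ) (a₁ a₂ : ℂ),
      IsEigenstate (noiseOp θ₁ φ) u₁ → IsEigenstate (noiseOp θ₁ φ) u₂ →
      IsUnitVec e₁ → IsUnitVec e₂ → dotProduct (star e₁) e₂ = 0 → ‖a₁‖ ^ 2 + ‖a₂‖ ^ 2 = 1 →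
      HasMeasureResetQFI T (extend n (signalOp θ₁ φ)) ![γ₂]
        (fun k => extend n (![noiseOp θ₁ φ] k)) (a₁ • tensorVec u₁ e₁ + a₂ • tensorVec u₂ e₂)
        (ENNReal.ofReal (4 * T * noisyRate θ₁)) := fun n u₁ u₂ e₁ e₂ a₁ a₂ hu₁ hu₂ he₁ he₂ he ha =>
    (detects_tensor hu₁.1 hu₂.1 (hev u₁ hu₁) (hev u₂ hu₂) he₁ he₂ he ha hu₁.rate
      hu₂.rate).hasMeasureResetQFI (hub.hasRateBound n)
      (isUnitVec_tensor hu₁.1 hu₂.1 he₁ he₂ he ha) hT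
  obtain ⟨u, hu⟩ := exists_isEigenstate (noiseOp θ₁ φ)
  rw [noisyValue_eq, noiselessValue_eq]
  refine ⟨isOptimalQFI_of_detects hub hu.1 (detects_perp hu.1 (hev u hu) hu.rate) hT, hreset, hext,
    ⟨?_, ?_⟩, ⟨⟨u, hu.1, (hreset u hu).eq.symm⟩, ?_⟩, isOptimalQFI_noiseless θ₁ φ hT,
    fun h => by rw [(noisyRate_compare θ₁).1 h],
    fun h => mul_lt_mul_of_pos_left ((noisyRate_compare θ₁).2 h) (by positivity)⟩
  · have he₁ : IsUnitVec (![1, 0] : Fin 2 → ℂ) := by simp [IsUnitVec, dotProduct]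
    have he₂ : IsUnitVec (![0, 1] : Fin 2 → ℂ) := by simp [IsUnitVec, dotProduct]
    have he : star (![1, 0] : Fin 2 → ℂ) ⬝ᵥ ![0, 1] = 0 := by simp [dotProduct]
    have ha : ‖(1 : ℂ)‖ ^ 2 + ‖(0 : ℂ)‖ ^ 2 = 1 := by simp
    -- The product state `u ⊗ e₁`, with coefficients `1` and `0`, already attains the extended
    -- maximum.
    exact ⟨2, _, isUnitVec_tensor hu.1 hu.1 he₁ he₂ he ha,
      (hext 2 u u _ _ 1 0 hu hu he₁ he₂ he ha).eq.symm⟩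
  · rintro _ ⟨n, ψ, hψ, rfl⟩
    exact measureResetQFI_le (hub.hasRateBound n) hψ hT
  · rintro _ ⟨ψ, hψ, rfl⟩
    exact measureResetQFI_le hb hψ hT
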